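/- Let $M$ be an oriented smooth $m$-manifold ($m\ge 1$), $\mathcal E\to M$ a smooth vector bundle of rank $m$ with a smooth fibre metric $\langle\ ,\ \rangle$, $D$ a smooth metric connection on $\mathcal E$, and $\varphi,\psi\colon TM\to\mathcal E$ smooth bundle homomorphisms such that for $\theta\in\{\varphi,\psi\}$ and all vector fields $X,Y$ one has $D_X\theta(Y)-D_Y\theta(X)-\theta([X,Y])=0$, such that $\langle\varphi(X),\psi(Y)\rangle=\langle\varphi(Y),\psi(X)\rangle$, and such that $\ker\varphi_x\cap\ker\psi_x=\{0\}$ for every $x\in M$; that is, $(M,\mathcal E,\langle\ ,\ \rangle,D,\varphi,\psi)$ is a front bundle. Let $\mathcal E$ be co-oriented by a smooth section $\mu$ of $\det\mathcal E^*$ with values $\pm1$ on orthonormal frames. Let $\Sigma=\{x\in M:\varphi_x\text{ is not bijective}\}$, and in a positively oriented coordinate system $(u_1,\dots,u_m)$ put $\lambda=\mu(\varphi(\partial_1),\dots,\varphi(\partial_m))$, so that $\Sigma=\{\lambda=0\}$ there. A point $p\in\Sigma$ is an $A_2$-point if $d\lambda_p\ne 0$ and $\ker\varphi_p$ is transversal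 to $T_p\Sigma=\ker d\lambda_p$. Put $I(X,Y)=\langle\varphi(X),\varphi(Y)\rangle$, $I\!I(X,Y)=-\langle\varphi(X),\psi(Y)\rangle$ and, for $q\in M\setminus\Sigma$ and linearly independent $X,Y\in T_qM$, $$K^{\mathrm{ext}}(X\wedge Y)=\frac{I\!I(X,X)\,I\!I(Y,Y)-I\!I(X,Y)^2}{I(X,X)\,I(Y,Y)-I(X,Y)^2}.$$ At an $A_2$-point $p$ choose, near $p$, a smooth $I$-orthonormal frame $e_1,\dots,e_{m-1}$ which is tangent to $\Sigma$ along $\Sigma$, the smooth section $n$ of $\mathcal E$ for which $(\varphi(e_1),\dots,\varphi(e_{m-1}),n)$ is orthonormal with $\mu(\varphi(e_1),\dots,\varphi(e_{m-1}),n)=1$, and $\eta\in\ker\varphi_p$ for which $(e_1,\dots,e_{m-1},\eta)$ is a positively oriented basis of $T_pM$. The singular principal curvatures at $p$ are the eigenvalues of the singular shape operator $S(X)=-\operatorname{sgn}(d\lambda_p(\eta))\,\varphi^{-1}(D_Xn)$ on $T_p\Sigma$, where $\varphi^{-1}$ is the inverse of $\varphi_p|_{T_p\Sigma}$. Let $p\in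 M$ be an $A_2$-point of $\varphi$. Then the following hold. (1) If $K^{\mathrm{ext}}$ is bounded on $U\setminus\Sigma$ (over all points and all tangent planes) for some neighborhood $U$ of $p$, then $I\!I(X,Y)=0$ for all $X,Y\in T_pM$. (2) If $U$ is a neighborhood of $p$ such that $K^{\mathrm{ext}}$ does not change sign on $U\setminus\Sigma$ (it is everywhere $\ge0$ or everywhere $\le0$), then $K^{\mathrm{ext}}$ is bounded on $W\setminus\Sigma$ for some neighborhood $W\subseteq U$ of $p$. (3) If $K^{\mathrm{ext}}\ge0$ on $U\setminus\Sigma$ for some neighborhood $U$ of $p$, then all singular principal curvatures at $p$ are $\le0$. Furthermore, if there are an open neighborhood $U$ of $p$, a smooth vector field $\tilde\eta$ on $U$ and a constant $\delta>0$ such that $\tilde\eta_q\ne0$ and $\varphi(\tilde\eta_q)=0$ for all $q\in U\cap\Sigma$, and $K^{\mathrm{ext}}(X\wedge\tilde\eta_q)\ge\delta$ for all $q\in U\setminus\Sigma$ and all $X\in T_qM$ with $X\wedge\tilde\eta_q\ne0$, then all singular principal curvatures at $p$ are $<0$. -/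

import Mathlib

open Bundle Set Filter Topology Manifold
open scoped ContDiff

namespace FrontBundles

noncomputable section

/-- A tuple `v` of vectors is a basis that is positive for the orientation `o`. -/
def IsPositiveFrame {m : ℕ} {W : Type*} [AddCommGroup W] [Module ℝ W]
    (o : Orientation ℝ W (Fin m)) (v : Fin m → W) : Prop :=
  ∃ b : Module.Basis (Fin m) ℝ W, ⇑b = v ∧ b.orientation = o

section Base

variable {k : ℕ} {M : Type*} [TopologicalSpace M]
  [ChartedSpace (EuclideanSpace ℝ (Fin (k + 1))) M]

/-- The coordinate vector `∂/∂u_j` at `x` of the coordinate system `e = (u_1, …, u_m)`. -/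
def coordVec (e : OpenPartialHomeomorph M (EuclideanSpace ℝ (Fin (k + 1)))) (j : Fin (k + 1))
    (x : M) : TangentSpace (𝓡 (k + 1)) x :=
  (mvfderiv (𝓡 (k + 1)) e x).inverse (EuclideanSpace.single j (1 : ℝ))

/-- `e` is a smooth local coordinate system compatible with a pointwise choice `o` of
orientations of the tangent spaces. -/
def IsPositiveChart (o : ∀ x : M, Orientation ℝ (TangentSpace (𝓡 (k + 1)) x) (Fin (k + 1)))
    (e : OpenPartialHomeomorph M (EuclideanSpace ℝ (Fin (k + 1)))) : Prop :=
  e ∈ IsManifold.maximalAtlas (𝓡 (k + 1)) ∞ M ∧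
    ∀ x ∈ e.source, IsPositiveFrame (o x) (fun j => coordVec e j x)

/-- `o` is an orientation of the manifold `M`: around every point there is a positive chart. -/
def IsManifoldOrientation
    (o : ∀ x : M, Orientation ℝ (TangentSpace (𝓡 (k + 1)) x) (Fin (k + 1))) : Prop :=
  ∀ p : M, ∃ e, p ∈ e.source ∧ IsPositiveChart o e

end Base

variable {k : ℕ} {M : Type*} [TopologicalSpace M]
  [ChartedSpace (EuclideanSpace ℝ (Fin (k + 1))) M]
  [IsManifold (𝓡 (k + 1)) ∞ M]
  {F : Type*} [NormedAddCommGroup F] [NormedSpace ℝ F] [FiniteDimensional ℝ F]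
  {V : M → Type*} [TopologicalSpace (TotalSpace F V)]
  [∀ x, NormedAddCommGroup (V x)] [∀ x, InnerProductSpace ℝ (V x)]
  [FiberBundle F V] [VectorBundle ℝ F V]
  [ContMDiffVectorBundle ∞ F V (𝓡 (k + 1))]
  [IsContMDiffRiemannianBundle (𝓡 (k + 1)) ∞ F V]

/-- `(M, V, ⟨,⟩, D, φ)` is a coherent tangent bundle: `V` has rank `m = k + 1 = dim M`, `D` is a
smooth metric connection, and `φ : TM → V` is a smooth bundle homomorphism with
`D_X φ(Y) - D_Y φ(X) - φ([X, Y]) = 0`. Note that `D σ x (X x)` is `(D_X σ)(x)`. -/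
structure IsCoherentTangentBundle (D : CovariantDerivative (𝓡 (k + 1)) F V)
    (φ : ∀ x : M, TangentSpace (𝓡 (k + 1)) x →L[ℝ] V x) : Prop where
  rank_eq : Module.finrank ℝ F = k + 1
  smooth_connection : CovariantDerivative.ContMDiffCovariantDerivative D ∞
  metric : D.IsMetricCompatible
  smooth_hom : ContMDiff (𝓡 (k + 1))
    ((𝓡 (k + 1)).prod 𝓘(ℝ, EuclideanSpace ℝ (Fin (k + 1)) →L[ℝ] F)) ∞
    (fun x => TotalSpace.mk' (EuclideanSpace ℝ (Fin (k + 1)) →L[ℝ] F) x (φ x))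
  coherent : ∀ (x : M) (X Y : ∀ y : M, TangentSpace (𝓡 (k + 1)) y),
    MDifferentiableAt (𝓡 (k + 1)) ((𝓡 (k + 1)).prod 𝓘(ℝ, EuclideanSpace ℝ (Fin (k + 1))))
      (fun y => TotalSpace.mk' (EuclideanSpace ℝ (Fin (k + 1))) y (X y)) x →
    MDifferentiableAt (𝓡 (k + 1)) ((𝓡 (k + 1)).prod 𝓘(ℝ, EuclideanSpace ℝ (Fin (k + 1))))
      (fun y => TotalSpace.mk' (EuclideanSpace ℝ (Fin (k + 1))) y (Y y)) x →
      D (fun y => φ y (Y y)) x (X x) - D (fun y => φ y (X y)) x (Y x)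
        - φ x (VectorField.mlieBracket (𝓡 (k + 1)) X Y x) = 0

/-- `(M, V, ⟨,⟩, D, φ, ψ)` is a front bundle. -/
structure IsFrontBundle (D : CovariantDerivative (𝓡 (k + 1)) F V)
    (φ ψ : ∀ x : M, TangentSpace (𝓡 (k + 1)) x →L[ℝ] V x) : Prop where
  coherent_fst : IsCoherentTangentBundle D φ
  coherent_snd : IsCoherentTangentBundle D ψ
  compatible : ∀ (x : M) (X Y : TangentSpace (𝓡 (k + 1)) x),
    inner ℝ (φ x X) (ψ x Y) = inner ℝ (φ x Y) (ψ x X)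
  front : ∀ (x : M) (X : TangentSpace (𝓡 (k + 1)) x), φ x X = 0 → ψ x X = 0 → X = 0

/-- A co-orientation: a smooth section `μ` of the determinant bundle of the dual of `V` which
takes the values `±1` on orthonormal frames. Smoothness is tested on smooth sections. -/
structure IsCoorientation (F : Type*) [NormedAddCommGroup F] [NormedSpace ℝ F]
    {V : M → Type*} [TopologicalSpace (TotalSpace F V)]
    [∀ x, NormedAddCommGroup (V x)] [∀ x, InnerProductSpace ℝ (V x)] [FiberBundle F V]
    (μ : ∀ x : M, V x [⋀^Fin (k + 1)]→ₗ[ℝ] ℝ) : Prop where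
  smooth : ∀ (s : Fin (k + 1) → ∀ x : M, V x) (p : M),
    (∀ i, ContMDiffAt (𝓡 (k + 1)) ((𝓡 (k + 1)).prod 𝓘(ℝ, F)) ∞
      (fun x => TotalSpace.mk' F x (s i x)) p) →
      ContMDiffAt (𝓡 (k + 1)) 𝓘(ℝ, ℝ) ∞ (fun x => μ x (fun i => s i x)) p
  unit : ∀ (x : M) (v : Fin (k + 1) → V x), Orthonormal ℝ v → μ x v = 1 ∨ μ x v = -1

section Pointwise

variable {k : ℕ} {M : Type*} [TopologicalSpace M]
  [ChartedSpace (EuclideanSpace ℝ (Fin (k + 1))) M]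
  {V : M → Type*} [∀ x, NormedAddCommGroup (V x)] [∀ x, InnerProductSpace ℝ (V x)]

/-- The singular set `Σ_φ`. -/
def singularSet (φ : ∀ x : M, TangentSpace (𝓡 (k + 1)) x →L[ℝ] V x) : Set M :=
  {x | ¬ Function.Bijective (φ x)}

/-- The first fundamental form `I`, i.e. the `φ`-metric. -/
def formI (φ : ∀ x : M, TangentSpace (𝓡 (k + 1)) x →L[ℝ] V x) (x : M)
    (X Y : TangentSpace (𝓡 (k + 1)) x) : ℝ :=
  inner ℝ (φ x X) (φ x Y)

/-- The second fundamental form `II`. -/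
def formII (φ ψ : ∀ x : M, TangentSpace (𝓡 (k + 1)) x →L[ℝ] V x) (x : M)
    (X Y : TangentSpace (𝓡 (k + 1)) x) : ℝ :=
  -inner ℝ (φ x X) (ψ x Y)

/-- The extrinsic curvature `K^ext(X ∧ Y)` at a regular point `x` of `φ`, for linearly
independent `X, Y`. -/
def extCurv (φ ψ : ∀ x : M, TangentSpace (𝓡 (k + 1)) x →L[ℝ] V x) (x : M)
    (X Y : TangentSpace (𝓡 (k + 1)) x) : ℝ :=
  (formII φ ψ x X X * formII φ ψ x Y Y - formII φ ψ x X Y ^ 2) /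
    (formI φ x X X * formI φ x Y Y - formI φ x X Y ^ 2)

/-- The property `P` holds for `K^ext` of every tangent plane at every point of `U \ Σ_φ`. -/
def ExtCurvOn (φ ψ : ∀ x : M, TangentSpace (𝓡 (k + 1)) x →L[ℝ] V x) (U : Set M)
    (P : ℝ → Prop) : Prop :=
  ∀ q ∈ U \ singularSet φ, ∀ X Y : TangentSpace (𝓡 (k + 1)) q,
    LinearIndependent ℝ ![X, Y] → P (extCurv φ ψ q X Y)

/-- The `φ`-Jacobian function `λ_φ = μ(φ(∂_1), …, φ(∂_m))` in the coordinate system `e`. -/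
def jacobian (μ : ∀ x : M, V x [⋀^Fin (k + 1)]→ₗ[ℝ] ℝ)
    (φ : ∀ x : M, TangentSpace (𝓡 (k + 1)) x →L[ℝ] V x)
    (e : OpenPartialHomeomorph M (EuclideanSpace ℝ (Fin (k + 1)))) (x : M) : ℝ :=
  μ x (fun j => φ x (coordVec e j x))

/-- The differential `dλ_φ` at `x`. -/
def dJacobian (μ : ∀ x : M, V x [⋀^Fin (k + 1)]→ₗ[ℝ] ℝ)
    (φ : ∀ x : M, TangentSpace (𝓡 (k + 1)) x →L[ℝ] V x)
    (e : OpenPartialHomeomorph M (EuclideanSpace ℝ (Fin (k + 1)))) (x : M) :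
    TangentSpace (𝓡 (k + 1)) x →L[ℝ] ℝ :=
  mvfderiv (𝓡 (k + 1)) (jacobian μ φ e) x

/-- The tangent space `T_xΣ_φ` of the singular submanifold `Σ_φ = {λ_φ = 0}` at a
non-degenerate singular point `x`, as the kernel of `dλ_φ` at `x`. -/
def singularTangent (μ : ∀ x : M, V x [⋀^Fin (k + 1)]→ₗ[ℝ] ℝ)
    (φ : ∀ x : M, TangentSpace (𝓡 (k + 1)) x →L[ℝ] V x)
    (e : OpenPartialHomeomorph M (EuclideanSpace ℝ (Fin (k + 1)))) (x : M) :
    Submodule ℝ (TangentSpace (𝓡 (k + 1)) x) :=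
  (dJacobian μ φ e x).ker

/-- `p` is an `A_2`-point of `φ`: a non-degenerate singular point at which the null direction is
transversal to the singular submanifold. (The conditions do not depend on the positive
chart.) -/
def IsA2Point (o : ∀ x : M, Orientation ℝ (TangentSpace (𝓡 (k + 1)) x) (Fin (k + 1)))
    (μ : ∀ x : M, V x [⋀^Fin (k + 1)]→ₗ[ℝ] ℝ)
    (φ : ∀ x : M, TangentSpace (𝓡 (k + 1)) x →L[ℝ] V x) (p : M) : Prop :=
  p ∈ singularSet φ ∧ ∃ e, p ∈ e.source ∧ IsPositiveChart o e ∧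
    dJacobian μ φ e p ≠ 0 ∧ (φ p).ker ⊔ singularTangent μ φ e p = ⊤

end Pointwise

/-- The choices made in the definition of the singular shape operator at an `A_2`-point `p`. -/
structure AdaptedFrame (F : Type*) [NormedAddCommGroup F] [NormedSpace ℝ F]
    {V : M → Type*} [TopologicalSpace (TotalSpace F V)]
    [∀ x, NormedAddCommGroup (V x)] [∀ x, InnerProductSpace ℝ (V x)] [FiberBundle F V]
    (o : ∀ x : M, Orientation ℝ (TangentSpace (𝓡 (k + 1)) x) (Fin (k + 1)))
    (μ : ∀ x : M, V x [⋀^Fin (k + 1)]→ₗ[ℝ] ℝ)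
    (φ : ∀ x : M, TangentSpace (𝓡 (k + 1)) x →L[ℝ] V x) (p : M) where
  /-- A local coordinate system compatible with the orientation. -/
  chart : OpenPartialHomeomorph M (EuclideanSpace ℝ (Fin (k + 1)))
  chart_pos : IsPositiveChart o chart
  /-- A neighborhood of `p`. -/
  dom : Set M
  dom_open : IsOpen dom
  mem_dom : p ∈ dom
  dom_subset : dom ⊆ chart.source
  /-- A smooth frame `e_1, …, e_{m-1}`, orthonormal for the `φ`-metric and tangent to the
  singular set along it. -/
  vec : Fin k → ∀ x : M, TangentSpace (𝓡 (k + 1)) x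
  vec_smooth : ∀ i, ContMDiffOn (𝓡 (k + 1))
    ((𝓡 (k + 1)).prod 𝓘(ℝ, EuclideanSpace ℝ (Fin (k + 1)))) ∞
    (fun x => TotalSpace.mk' (EuclideanSpace ℝ (Fin (k + 1))) x (vec i x)) dom
  vec_orthonormal : ∀ q ∈ dom, ∀ i j,
    formI φ q (vec i q) (vec j q) = if i = j then 1 else 0
  vec_tangent : ∀ q ∈ dom ∩ singularSet φ, ∀ i, vec i q ∈ singularTangent μ φ chart q
  /-- The conormal vector field `n`: the frame `(φ(e_1), …, φ(e_{m-1}), n)` is orthonormal and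
  positive. -/
  conormal : ∀ x : M, V x
  conormal_smooth : ContMDiffOn (𝓡 (k + 1)) ((𝓡 (k + 1)).prod 𝓘(ℝ, F)) ∞
    (fun x => TotalSpace.mk' F x (conormal x)) dom
  frame_orthonormal : ∀ q ∈ dom, Orthonormal ℝ
    (Fin.snoc (α := fun _ => V q) (fun i => φ q (vec i q)) (conormal q))
  frame_pos : ∀ q ∈ dom,
    μ q (Fin.snoc (α := fun _ => V q) (fun i => φ q (vec i q)) (conormal q)) = 1
  /-- The null vector `η` at `p` such that `(e_1, …, e_{m-1}, η)` is positive. -/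
  null : TangentSpace (𝓡 (k + 1)) p
  null_mem : φ p null = 0
  null_pos : IsPositiveFrame (o p)
    (Fin.snoc (α := fun _ => TangentSpace (𝓡 (k + 1)) p) (fun i => vec i p) null)

/-- The singular shape operator `S_φ(X) = -sgn(dλ_φ(η)) φ⁻¹(D_X n)` on `T_pΣ_φ`, where `φ⁻¹` is
the inverse of the restriction of `φ` to `T_pΣ_φ`. -/
def AdaptedFrame.shapeOperator
    {o : ∀ x : M, Orientation ℝ (TangentSpace (𝓡 (k + 1)) x) (Fin (k + 1))}
    {μ : ∀ x : M, V x [⋀^Fin (k + 1)]→ₗ[ℝ] ℝ}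
    {φ : ∀ x : M, TangentSpace (𝓡 (k + 1)) x →L[ℝ] V x} {p : M}
    (A : AdaptedFrame F o μ φ p) (D : CovariantDerivative (𝓡 (k + 1)) F V) :
    singularTangent μ φ A.chart p →ₗ[ℝ] singularTangent μ φ A.chart p :=
  (-Real.sign (dJacobian μ φ A.chart p A.null)) •
    (((φ p).toLinearMap.domRestrict (singularTangent μ φ A.chart p)).leftInverse ∘ₗ
      (D A.conormal p).toLinearMap.domRestrict (singularTangent μ φ A.chart p))

/-- `c` is a singular principal curvature at `p`, i.e. an eigenvalue of the singular shape
operator (which does not depend on the choice of the adapted frame). -/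
def IsSingularPrincipalCurvature (D : CovariantDerivative (𝓡 (k + 1)) F V)
    (o : ∀ x : M, Orientation ℝ (TangentSpace (𝓡 (k + 1)) x) (Fin (k + 1)))
    (μ : ∀ x : M, V x [⋀^Fin (k + 1)]→ₗ[ℝ] ℝ)
    (φ : ∀ x : M, TangentSpace (𝓡 (k + 1)) x →L[ℝ] V x) (p : M) (c : ℝ) : Prop :=
  ∃ A : AdaptedFrame F o μ φ p, Module.End.HasEigenvalue (A.shapeOperator D) c

end

end FrontBundles

/-!
Cramer's rule provides, for every section `n` of the bundle, a smooth vector field `η` with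
`φ(η) = λ n`, the cofactor field of `n`. Near `p` this makes the extrinsic curvature explicit:
with `f = ⟨φ(X), ψ(X)⟩`, `g = ⟨n, ψ(X)⟩`, `ρ = ⟨n, ψ(η)⟩` and `d` the squared area of the
parallelogram spanned by `φ(X)` and `n`,
`K^ext(X ∧ η) = λ (f ρ - λ g²) / (λ² d)`,
and `n` can be chosen with `ρ ≠ 0` at `p` because the bundle is a front.

If `K^ext` is bounded, then `f ρ - λ g²` is `O(λ)`, so `f` vanishes at `p`, which is (1). Since
`λ` takes both signs near every singular point close to `p`, a sign of `K^ext` also forces `f = 0`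
along the singular set; then `II = O(λ)`, and as every tangent plane contains vectors on which
`φ` is uniformly injective, the numerator of `K^ext` is bounded by a multiple of its denominator,
which is (2). For (3), the inequality `numerator ≥ δ · denominator` for `K^ext(X ∧ η)` is divided
by `λ²`; in the limit at `p` it bounds `⟨φ(X), D_X n⟩` by `δ |φ(X)|²` up to a factor of definite
sign, and on an eigenvector `X` of the singular shape operator this is a bound on the eigenvalue.
-/

namespace FrontBundles

section Analysis

variable {E F G H : Type*} [NormedAddCommGroup E] [NormedSpace ℝ E]
  [NormedAddCommGroup F] [NormedSpace ℝ F] [NormedAddCommGroup G] [NormedSpace ℝ G]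

theorem range_eq_top_of_ne_zero {L : E →L[ℝ] ℝ} (hL : L ≠ 0) : L.range = ⊤ :=
  Module.Dual.range_eq_top_of_ne_zero fun h =>
    hL (ContinuousLinearMap.coe_injective h)

variable [CompleteSpace E]

theorem isBigO_leftFun_of_eventually_eq_zero [CompleteSpace F] [CompleteSpace G]
    [NormedAddCommGroup H] [NormedSpace ℝ H] (Φ : ImplicitFunctionData ℝ E F G) {f : E → H}
    {f' : E →L[ℝ] H} (hf : HasStrictFDerivAt f f' Φ.pt) (h₀ : Φ.leftFun Φ.pt = 0)
    (hzero : ∀ᶠ x in 𝓝 Φ.pt, Φ.leftFun x = 0 → f x = 0) : f =O[𝓝 Φ.pt] Φ.leftFun := by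
  have hΦ := Φ.hasStrictFDerivAt
  set Ψ := hΦ.localInverse with hΨ
  have hΨ₀ : Ψ (Φ.prodFun Φ.pt) = Φ.pt := hΦ.localInverse_apply_image
  have hfΨ := HasStrictFDerivAt.comp (g := f) _ (by rwa [← hΨ, hΨ₀]) hΦ.to_localInverse
  have hproj : Tendsto (fun x => ((0 : F), Φ.rightFun x)) (𝓝 Φ.pt) (𝓝 (Φ.prodFun Φ.pt)) := by
    rw [Φ.prodFun_apply, h₀]
    exact tendsto_const_nhds.prodMk_nhds Φ.hasStrictFDerivAt_rightFun.continuousAt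
  have hΨproj : Tendsto (fun x => Ψ (0, Φ.rightFun x)) (𝓝 Φ.pt) (𝓝 Φ.pt) := by
    simpa only [← hΨ, hΨ₀, Function.comp_def] using
      hΦ.to_localInverse.continuousAt.tendsto.comp hproj
  have hO := hfΨ.isBigO_sub.comp_tendsto (hΦ.continuousAt.tendsto.prodMk_nhds hproj)
  refine hO.congr' ?_ (Eventually.of_forall fun x => ?_) |>.trans
    (Asymptotics.isBigO_refl Φ.leftFun _ |>.prod_left (Asymptotics.isBigO_zero _ _))
  · filter_upwards [hΦ.eventually_left_inverse, hproj.eventually hΦ.eventually_right_inverse,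
      hΨproj.eventually hzero] with x hx hxΨ hfx
    have hfst : Φ.leftFun (Ψ (0, Φ.rightFun x)) = 0 := congrArg Prod.fst hxΨ
    simp only [Function.comp_apply, ← hΨ, hfx hfst, sub_zero]
    exact congrArg f hx
  · simp

theorem isBigO_of_eventually_eq_zero [FiniteDimensional ℝ F] {f : E → G} {g : E → F}
    {f' : E →L[ℝ] G} {g' : E →L[ℝ] F} {x₀ : E} (hf : HasStrictFDerivAt f f' x₀)
    (hg : HasStrictFDerivAt g g' x₀) (hsurj : g'.range = ⊤) (hg₀ : g x₀ = 0)
    (hfg : ∀ᶠ x in 𝓝 x₀, g x = 0 → f x = 0) : f =O[𝓝 x₀] g :=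
  have := FiniteDimensional.complete ℝ F
  isBigO_leftFun_of_eventually_eq_zero (hg.implicitFunctionDataOfComplemented g g' hsurj
    g'.ker_closedComplemented_of_finiteDimensional_range) hf hg₀ hfg

theorem eventually_map_nhds_eq_of_surjective [CompleteSpace F] {g : E → F} {g' : E →L[ℝ] F}
    {x₀ : E} (hg : HasStrictFDerivAt g g' x₀) (hsurj : g'.range = ⊤) :
    ∀ᶠ x in 𝓝 x₀, map g (𝓝 x) = 𝓝 (g x) := by
  let right := g'.nonlinearRightInverseOfSurjective hsurj
  have hright : 0 < right.nnnorm := g'.nonlinearRightInverseOfSurjective_nnnorm_pos hsurj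
  obtain ⟨s, hs, happrox⟩ := hg.approximates_deriv_on_nhds (c := right.nnnorm⁻¹ / 2)
    (.inr (by positivity))
  filter_upwards [eventually_mem_nhds_iff.2 hs] with x hx
  exact happrox.map_nhds_eq right hx (.inr (NNReal.half_lt_self (by positivity)))

end Analysis

section ManifoldAnalysis

variable {E : Type*} [NormedAddCommGroup E] [NormedSpace ℝ E]
  {H : Type*} [TopologicalSpace H] {I : ModelWithCorners ℝ E H} [I.Boundaryless]
  {M : Type*} [TopologicalSpace M] [ChartedSpace H M] {p : M}

theorem hasFDerivAt_comp_extChartAt_symm {f : M → ℝ} (hf : MDifferentiableAt I 𝓘(ℝ, ℝ) f p) :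
    HasFDerivAt (f ∘ (extChartAt I p).symm) (mvfderiv I f p) (extChartAt I p p) := by
  have hdiff := hf.differentiableWithinAt_writtenInExtChartAt
  have hderiv := hf.mvfderiv
  simp only [I.range_eq_univ, fderivWithin_univ, differentiableWithinAt_univ] at hdiff hderiv
  exact hderiv ▸ hdiff.hasFDerivAt

theorem hasStrictFDerivAt_comp_extChartAt_symm {f : M → ℝ} {n : ℕ∞ω}
    (hf : ContMDiffAt I 𝓘(ℝ, ℝ) n f p) (hn : n ≠ 0) :
    HasStrictFDerivAt (f ∘ (extChartAt I p).symm) (mvfderiv I f p) (extChartAt I p p) := by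
  have h := (contMDiffAt_iff.1 hf).2
  simp only [I.range_eq_univ, contDiffWithinAt_univ] at h
  exact ContDiffAt.hasStrictFDerivAt' h
    (hasFDerivAt_comp_extChartAt_symm (hf.mdifferentiableAt hn)) hn

theorem eventually_nhds_iff_extChartAt_symm {P : M → Prop} :
    (∀ᶠ q in 𝓝 p, P q) ↔ ∀ᶠ x in 𝓝 (extChartAt I p p), P ((extChartAt I p).symm x) := by
  rw [← map_extChartAt_symm_nhdsWithin_range (I := I) p, I.range_eq_univ, nhdsWithin_univ,
    eventually_map]

theorem exists_curve_hasDerivAt (v : TangentSpace I p) :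
    ∃ γ : ℝ → M, Tendsto γ (𝓝 0) (𝓝 p) ∧ γ 0 = p ∧ ∀ f : M → ℝ,
      MDifferentiableAt I 𝓘(ℝ, ℝ) f p → HasDerivAt (f ∘ γ) (mvfderiv I f p v) 0 := by
  let w : E := v
  let c : ℝ → E := fun t => extChartAt I p p + t • w
  have hc : HasDerivAt c w 0 := by
    simpa [c] using ((hasDerivAt_id (0 : ℝ)).smul_const w).const_add (extChartAt I p p)
  have hc₀ : c 0 = extChartAt I p p := by simp [c]
  refine ⟨(extChartAt I p).symm ∘ c, ?_, by simp [hc₀], fun f hf => ?_⟩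
  · have hsymm := continuousAt_extChartAt_symm (I := I) p
    rw [← hc₀] at hsymm
    simpa [ContinuousAt, hc₀] using hsymm.comp hc.continuousAt
  · have hf' := hasFDerivAt_comp_extChartAt_symm hf
    rw [← hc₀] at hf'
    exact hf'.comp_hasDerivAt 0 hc

theorem exists_filter_tendsto_div {g : M → ℝ} (hg : MDifferentiableAt I 𝓘(ℝ, ℝ) g p)
    (hg₀ : g p = 0) {v : TangentSpace I p} (hv : mvfderiv I g p v ≠ 0) :
    ∃ l : Filter M, l.NeBot ∧ l ≤ 𝓝 p ∧ (∀ᶠ q in l, g q ≠ 0) ∧ ∀ f : M → ℝ,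
      MDifferentiableAt I 𝓘(ℝ, ℝ) f p → f p = 0 →
        Tendsto (fun q => f q / g q) l (𝓝 (mvfderiv I f p v / mvfderiv I g p v)) := by
  obtain ⟨γ, hγ, hγ₀, hderiv⟩ := exists_curve_hasDerivAt v
  have hslope : ∀ f : M → ℝ, MDifferentiableAt I 𝓘(ℝ, ℝ) f p → f p = 0 →
      Tendsto (fun t : ℝ => t⁻¹ * f (γ t)) (𝓝[≠] 0) (𝓝 (mvfderiv I f p v)) := by
    intro f hf hf₀
    simpa [hγ₀, hf₀] using hasDerivAt_iff_tendsto_slope_zero.1 (hderiv f hf)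
  refine ⟨map γ (𝓝[≠] 0), inferInstance, (map_mono nhdsWithin_le_nhds).trans hγ, ?_, ?_⟩
  · rw [eventually_map]
    filter_upwards [(hslope g hg hg₀).eventually_ne hv] with t ht h0
    simp [h0] at ht
  · intro f hf hf₀
    rw [tendsto_map'_iff]
    refine ((hslope f hf hf₀).div (hslope g hg hg₀) hv).congr' ?_
    filter_upwards [self_mem_nhdsWithin] with t ht
    have ht : t ≠ 0 := ht
    simp only [Function.comp_apply, Pi.div_apply]
    field_simp

theorem mvfderiv_eq_zero_of_isBigO {f g : M → ℝ} (hf : MDifferentiableAt I 𝓘(ℝ, ℝ) f p)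
    (hg : MDifferentiableAt I 𝓘(ℝ, ℝ) g p) (hg₀ : g p = 0) (hfg : f =O[𝓝 p] g)
    {v : TangentSpace I p} (hv : mvfderiv I g p v = 0) : mvfderiv I f p v = 0 := by
  obtain ⟨γ, hγ, hγ₀, hderiv⟩ := exists_curve_hasDerivAt v
  have hf₀ : f p = 0 := by
    obtain ⟨C, hC⟩ := hfg.bound
    simpa [hg₀] using hC.self_of_nhds
  have hcomp : HasDerivAt (f ∘ γ) 0 0 := by
    have hgγ := hderiv g hg
    rw [hv, hasDerivAt_iff_isLittleO] at hgγ
    rw [hasDerivAt_iff_isLittleO]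
    simp only [Function.comp_apply, hγ₀, hf₀, hg₀, sub_zero, smul_zero] at hgγ ⊢
    exact (hfg.comp_tendsto hγ).trans_isLittleO hgγ
  exact (hderiv f hf).unique hcomp

variable [CompleteSpace E] {f g : M → ℝ} {n : ℕ∞ω}

theorem isBigO_of_eventually_eq_zero_of_mvfderiv_ne_zero
    (hf : ContMDiffAt I 𝓘(ℝ, ℝ) n f p) (hg : ContMDiffAt I 𝓘(ℝ, ℝ) n g p) (hn : n ≠ 0)
    (hdg : mvfderiv I g p ≠ 0) (hg₀ : g p = 0) (hfg : ∀ᶠ q in 𝓝 p, g q = 0 → f q = 0) :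
    f =O[𝓝 p] g := by
  have h := isBigO_of_eventually_eq_zero (E := E) (hasStrictFDerivAt_comp_extChartAt_symm hf hn)
    (hasStrictFDerivAt_comp_extChartAt_symm hg hn) (range_eq_top_of_ne_zero hdg)
    (by simpa using hg₀) (eventually_nhds_iff_extChartAt_symm (I := I).1 hfg)
  obtain ⟨C, hC⟩ := h.bound
  exact .of_bound C (eventually_nhds_iff_extChartAt_symm.2 hC)

theorem mvfderiv_eq_zero_of_eventually_eq_zero
    (hf : ContMDiffAt I 𝓘(ℝ, ℝ) n f p) (hg : ContMDiffAt I 𝓘(ℝ, ℝ) n g p) (hn : n ≠ 0)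
    (hdg : mvfderiv I g p ≠ 0) (hg₀ : g p = 0) (hfg : ∀ᶠ q in 𝓝 p, g q = 0 → f q = 0)
    {v : TangentSpace I p} (hv : mvfderiv I g p v = 0) : mvfderiv I f p v = 0 :=
  mvfderiv_eq_zero_of_isBigO (hf.mdifferentiableAt hn) (hg.mdifferentiableAt hn) hg₀
    (isBigO_of_eventually_eq_zero_of_mvfderiv_ne_zero hf hg hn hdg hg₀ hfg) hv

theorem eventually_nhds_le_map_of_mvfderiv_ne_zero (hg : ContMDiffAt I 𝓘(ℝ, ℝ) n g p)
    (hn : n ≠ 0) (hdg : mvfderiv I g p ≠ 0) : ∀ᶠ q in 𝓝 p, 𝓝 (g q) ≤ map g (𝓝 q) := by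
  have h := eventually_map_nhds_eq_of_surjective (E := E)
    (hasStrictFDerivAt_comp_extChartAt_symm hg hn) (range_eq_top_of_ne_zero hdg)
  rw [eventually_nhds_iff_extChartAt_symm (I := I)]
  filter_upwards [h, extChartAt_target_mem_nhds p] with x hx hxt
  rw [← Function.comp_apply (f := g), ← hx, ← Filter.map_map]
  exact map_mono (continuousAt_extChartAt_symm'' (I := I) hxt)

theorem eventually_eq_zero_of_mul_nonneg (hg : ContMDiffAt I 𝓘(ℝ, ℝ) n g p) (hn : n ≠ 0)
    (hdg : mvfderiv I g p ≠ 0) (hf : ∀ᶠ q in 𝓝 p, ContinuousAt f q)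
    (hfg : ∀ᶠ q in 𝓝 p, g q ≠ 0 → 0 ≤ g q * f q) : ∀ᶠ q in 𝓝 p, g q = 0 → f q = 0 := by
  filter_upwards [eventually_nhds_le_map_of_mvfderiv_ne_zero hg hn hdg, hf, hfg.eventually_nhds]
    with q hq hfq hfgq hgq
  rw [hgq] at hq
  by_contra! hne
  rcases hne.lt_or_gt with hneg | hpos
  · have : ∃ᶠ y in 𝓝 q, 0 < g y :=
      (frequently_gt_nhds (0 : ℝ)).filter_mono hq
    obtain ⟨y, hy, hfy, hfgy⟩ := (this.and_eventually
      ((hfq.eventually_lt continuousAt_const hneg).and hfgq)).exists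
    nlinarith [hfgy hy.ne']
  · have : ∃ᶠ y in 𝓝 q, g y < 0 :=
      (frequently_lt_nhds (0 : ℝ)).filter_mono hq
    obtain ⟨y, hy, hfy, hfgy⟩ := (this.and_eventually
      ((continuousAt_const.eventually_lt hfq hpos).and hfgq)).exists
    nlinarith [hfgy hy.ne]

end ManifoldAnalysis

section Alternating

variable {R ι W N : Type*} [CommRing R] [AddCommGroup W] [Module R W] [AddCommGroup N] [Module R N]
  [DecidableEq ι]

theorem alternatingMap_update_add_smul [Finite ι] (ν : W [⋀^ι]→ₗ[R] N) (i : ι) (n : W) (w : ι → W)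
    (c : ι → R) :
    ν (Function.update (fun j => w j + c j • n) i n) = ν (Function.update w i n) := by
  have := Fintype.ofFinite ι
  set v : ι → W := fun j => w j + c j • n
  suffices H : ∀ s : Finset ι,
      ν (Function.update (s.piecewise v w) i n) = ν (Function.update w i n) by
    simpa using H Finset.univ
  intro s
  induction s using Finset.induction_on with
  | empty => simp
  | insert a s ha ih =>
    rw [Finset.piecewise_insert]
    rcases eq_or_ne a i with rfl | hai
    · rw [Function.update_idem, ih]
    have hrep : ν (Function.update (Function.update (s.piecewise v w) i n) a n) = 0 :=
      ν.map_eq_zero_of_eq (i := a) (j := i) _ (by simp [hai.symm]) hai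
    have hwa : s.piecewise v w a = w a := s.piecewise_eq_of_notMem _ _ ha
    rw [Function.update_comm hai, ν.map_update_add, ν.map_update_smul, hrep, smul_zero, add_zero,
      ← hwa, Function.update_comm hai.symm, Function.update_eq_self, ih]

variable [Fintype ι]

theorem alternatingMap_update_sum_smul (ν : W [⋀^ι]→ₗ[R] N) (v : ι → W) (a : ι → R) (j : ι) :
    ν (Function.update v j (∑ l, a l • v l)) = a j • ν v := by
  rw [ν.map_update_sum, Finset.sum_eq_single j]
  · rw [ν.map_update_smul, Function.update_eq_self]
  · intro l _ hl
    rw [ν.map_update_smul, ν.map_update_self _ hl.symm, smul_zero]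
  · simp

theorem alternatingMap_cramer (b : Module.Basis ι R W) (ν : W [⋀^ι]→ₗ[R] R) (v : ι → W) (u : W) :
    ∑ i, ν (Function.update v i u) • v i = ν v • u := by
  have hdet : ∀ w, ν w = ν b * (b.toMatrix w).det := fun w => by
    conv_lhs => rw [ν.eq_smul_basis_det b]
    simp [Module.Basis.det_apply]
  refine b.repr.injective (Finsupp.ext fun l => ?_)
  have hcramer := congrFun (Matrix.mulVec_cramer (b.toMatrix v) (b.repr u)) l
  simp only [Matrix.mulVec, dotProduct, Matrix.cramer_apply, Pi.smul_apply, smul_eq_mul] at hcramer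
  simp only [map_sum, map_smul, Finsupp.coe_finsetSum, Finset.sum_apply, Finsupp.smul_apply,
    smul_eq_mul]
  calc _ = ν b * ∑ i, b.toMatrix v l i * ((b.toMatrix v).updateCol i (b.repr u)).det := by
        rw [Finset.mul_sum]
        refine Finset.sum_congr rfl fun i _ => ?_
        rw [Module.Basis.toMatrix_apply, hdet, b.toMatrix_update]
        ring
    _ = _ := by rw [hcramer, hdet v]; ring

/-- The cofactor vector of `T` along `n` in the basis `b`. For an alternating form `ν` of top
degree it is mapped by `T` to a multiple of `n`, and where `T` degenerates it spans the kernel. -/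
def cofactorVec {V : Type*} [AddCommGroup V] [Module R V] (ν : V [⋀^ι]→ₗ[R] R) (b : ι → W)
    (T : W →ₗ[R] V) (n : V) : W :=
  ∑ i, ν (Function.update (fun j => T (b j)) i n) • b i

variable {V : Type*} [AddCommGroup V] [Module R V]

theorem map_cofactorVec (B : Module.Basis ι R V) (ν : V [⋀^ι]→ₗ[R] R) (b : ι → W) (T : W →ₗ[R] V)
    (n : V) : T (cofactorVec ν b T n) = ν (fun j => T (b j)) • n := by
  simp only [cofactorVec, map_sum, map_smul]
  exact alternatingMap_cramer B ν (fun j => T (b j)) n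

theorem cofactorVec_eq_smul_of_map_eq (ν : V [⋀^ι]→ₗ[R] R) (b : Module.Basis ι R W)
    (T : W →ₗ[R] V) {n : V} {Z : W} (ℓ : W →ₗ[R] R) (hTZ : T Z = 0) (hℓZ : ℓ Z = 1) :
    cofactorVec ν b T n = ν (fun j => (T + ℓ.smulRight n) (b j)) • Z := by
  have hZ : (T + ℓ.smulRight n) Z = n := by simp [hTZ, hℓZ]
  have hn : n = ∑ l, b.repr Z l • (T + ℓ.smulRight n) (b l) := by
    conv_lhs => rw [← hZ, ← b.sum_repr Z, map_sum]
    simp only [map_smul]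
  have hcoef : ∀ i, ν (Function.update (fun j => T (b j)) i n)
      = ν (fun j => (T + ℓ.smulRight n) (b j)) * b.repr Z i := by
    intro i
    rw [← alternatingMap_update_add_smul ν i n _ fun j => ℓ (b j)]
    conv_lhs => enter [2, 3]; rw [hn]
    exact (alternatingMap_update_sum_smul ν _ _ i).trans (mul_comm _ _)
  simp only [cofactorVec, hcoef, mul_smul, ← Finset.smul_sum, b.sum_repr]

end Alternating

section Kernel

variable {K W V : Type*} [Field K] [AddCommGroup W] [Module K W] [AddCommGroup V] [Module K V]

theorem exists_eq_smul_cofactorVec {ι : Type*} [Fintype ι] [DecidableEq ι] (ν : V [⋀^ι]→ₗ[K] K)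
    (b : Module.Basis ι K W) {T : W →ₗ[K] V} {n : V} (hcof : cofactorVec ν b T n ≠ 0) {Z : W}
    (hTZ : T Z = 0) : ∃ r : K, Z = r • cofactorVec ν b T n := by
  rcases eq_or_ne Z 0 with rfl | hZ
  · exact ⟨0, by simp⟩
  obtain ⟨ℓ, hℓ⟩ := Module.Projective.exists_dual_eq_one K hZ
  have hs := cofactorVec_eq_smul_of_map_eq ν b T (n := n) ℓ hTZ hℓ
  refine ⟨(ν fun j => (T + ℓ.smulRight n) (b j))⁻¹, ?_⟩
  rw [hs, inv_smul_smul₀]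
  rintro h₀
  exact hcof (by rw [hs, h₀, zero_smul])

theorem cofactorVec_eq_inv_det_smul {k : ℕ} (ν : V [⋀^Fin (k + 1)]→ₗ[K] K) (T : W →ₗ[K] V)
    (b B : Module.Basis (Fin (k + 1)) K W) {n : V} (hT : T (B (Fin.last k)) = 0)
    (hν : ν (Fin.snoc (α := fun _ => V) (fun i => T (B i.castSucc)) n) = 1) :
    cofactorVec ν b T n = (b.det B)⁻¹ • B (Fin.last k) := by
  set ℓ := B.coord (Fin.last k)
  set T' : W →ₗ[K] V := T + ℓ.smulRight n
  have hT' : (fun j => T' (B j)) = Fin.snoc (α := fun _ => V) (fun i => T (B i.castSucc)) n := by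
    funext j
    refine Fin.lastCases ?_ (fun i => ?_) j
    · simp [T', ℓ, hT]
    · simp [T', ℓ, (Fin.castSucc_lt_last i).ne]
  have hdet : ν (fun j => T' (B j)) = ν (fun j => T' (b j)) * b.det B :=
    congrArg (fun g => g B) ((ν.compLinearMap T').eq_smul_basis_det b)
  rw [cofactorVec_eq_smul_of_map_eq ν b T ℓ hT (by simp [ℓ])]
  congr 1
  exact eq_inv_of_mul_eq_one_left (by rw [← hdet, hT', hν])

end Kernel

section Hadamard

variable {m : ℕ} {W : Type*} [NormedAddCommGroup W] [InnerProductSpace ℝ W]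
  {ν : W [⋀^Fin (m + 1)]→ₗ[ℝ] ℝ}

theorem abs_alternatingMap_le_prod_norm (hm : Module.finrank ℝ W = m + 1)
    (hν : ∀ v : Fin (m + 1) → W, Orthonormal ℝ v → ν v = 1 ∨ ν v = -1) (v : Fin (m + 1) → W) :
    |ν v| ≤ ∏ i, ‖v i‖ := by
  have : Fact (Module.finrank ℝ W = m + 1) := ⟨hm⟩
  have : FiniteDimensional ℝ W := .of_fact_finrank_eq_succ m
  let b : OrthonormalBasis (Fin (m + 1)) ℝ W := (stdOrthonormalBasis ℝ W).reindex (finCongr hm)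
  have hadamard := b.toBasis.orientation.abs_volumeForm_apply_le v
  rw [b.toBasis.orientation.volumeForm_robust b rfl] at hadamard
  have hdet : ν v = ν b * b.toBasis.det v := by
    conv_lhs => rw [ν.eq_smul_basis_det b.toBasis]
    simp
  rw [hdet, abs_mul]
  rcases hν b b.orthonormal with hb | hb <;> simpa [hb] using hadamard

theorem norm_mul_abs_alternatingMap_le (hm : Module.finrank ℝ W = m + 1)
    (hν : ∀ v : Fin (m + 1) → W, Orthonormal ℝ v → ν v = 1 ∨ ν v = -1) {v : Fin (m + 1) → W}
    {R : ℝ} (hR : ∀ i, ‖v i‖ ≤ R) (a : Fin (m + 1) → ℝ) :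
    ‖a‖ * |ν v| ≤ R ^ m * ‖∑ l, a l • v l‖ := by
  obtain ⟨j, -, hj⟩ := Finset.exists_max_image Finset.univ (fun j => ‖a j‖) ⟨0, Finset.mem_univ 0⟩
  have ha : ‖a‖ ≤ |a j| := (pi_norm_le_iff_of_nonneg (abs_nonneg _)).2 fun l =>
    hj l (Finset.mem_univ l)
  calc ‖a‖ * |ν v| ≤ |a j| * |ν v| := by gcongr
    _ = |ν (Function.update v j (∑ l, a l • v l))| := by
      rw [alternatingMap_update_sum_smul, smul_eq_mul, abs_mul]
    _ ≤ ∏ l, ‖Function.update v j (∑ l, a l • v l) l‖ := abs_alternatingMap_le_prod_norm hm hν _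
    _ = (∏ l ∈ Finset.univ.erase j, ‖v l‖) * ‖∑ l, a l • v l‖ := by
      rw [← Finset.mul_prod_erase _ _ (Finset.mem_univ j), Function.update_self, mul_comm]
      congr 1
      exact Finset.prod_congr rfl fun l hl => by
        rw [Function.update_of_ne (Finset.ne_of_mem_erase hl)]
    _ ≤ R ^ m * ‖∑ l, a l • v l‖ := by
      gcongr
      simpa using Finset.prod_le_prod (s := Finset.univ.erase j) (fun l _ => norm_nonneg (v l))
        fun l _ => hR l

theorem norm_mul_abs_alternatingMap_update_le (hm : Module.finrank ℝ W = m + 1)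
    (hν : ∀ v : Fin (m + 1) → W, Orthonormal ℝ v → ν v = 1 ∨ ν v = -1) {v : Fin (m + 1) → W}
    {n : W} {R : ℝ} (hR : ∀ i, ‖v i‖ ≤ R) (hn : ‖n‖ ≤ R) {a : Fin (m + 1) → ℝ} {i : Fin (m + 1)}
    (ha : a i = 0) : ‖a‖ * |ν (Function.update v i n)| ≤ R ^ m * ‖∑ l, a l • v l‖ := by
  have hsum : ∑ l, a l • v l = ∑ l, a l • Function.update v i n l := by
    refine Finset.sum_congr rfl fun l _ => ?_
    rcases eq_or_ne l i with rfl | hl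
    · simp only [ha, zero_smul]
    · rw [Function.update_of_ne hl]
  rw [hsum]
  refine norm_mul_abs_alternatingMap_le hm hν (fun l => ?_) a
  rcases eq_or_ne l i with rfl | hl
  · rwa [Function.update_self]
  · rw [Function.update_of_ne hl]
    exact hR l

theorem alternatingMap_comp_basis_ne_zero_iff {X : Type*} [AddCommGroup X] [Module ℝ X]
    (hm : Module.finrank ℝ W = m + 1)
    (hν : ∀ v : Fin (m + 1) → W, Orthonormal ℝ v → ν v = 1 ∨ ν v = -1)
    (b : Module.Basis (Fin (m + 1)) ℝ X) (T : X →ₗ[ℝ] W) :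
    ν (fun j => T (b j)) ≠ 0 ↔ Function.Bijective T := by
  have : FiniteDimensional ℝ W := .of_finrank_eq_succ hm
  constructor
  · intro h
    have hli : LinearIndependent ℝ (T ∘ b) := by
      by_contra hli
      exact h (ν.map_linearDependent _ hli)
    exact T.bijective_of_linearIndependent_of_span_eq_top b.span_eq hli
      (hli.span_eq_top_of_card_eq_finrank (by simp [hm]))
  · intro h
    have hν₀ : ν ≠ 0 := by
      let e := (stdOrthonormalBasis ℝ W).reindex (finCongr hm)
      rintro rfl
      simpa using hν e e.orthonormal
    exact (ν.map_basis_ne_zero_iff (b.map (LinearEquiv.ofBijective T h))).2 hν₀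

end Hadamard

section CrossGram

variable {W E : Type*} [NormedAddCommGroup E] [InnerProductSpace ℝ E]

theorem norm_sq_smul_sub_inner_smul (u w : E) :
    ‖inner ℝ u u • w - inner ℝ u w • u‖ ^ 2
      = inner ℝ u u * (inner ℝ u u * inner ℝ w w - inner ℝ u w ^ 2) := by
  rw [← real_inner_self_eq_norm_sq]
  simp only [inner_sub_left, inner_sub_right, real_inner_smul_left, real_inner_smul_right,
    real_inner_comm u w]
  ring

/-- The mixed Gram determinant of the pair `X, Y` under `T` and `S`. For the bundle maps `φ, ψ` of
a front bundle, `crossGram φ ψ` is the numerator and `crossGram φ φ` the denominator of the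
extrinsic curvature. -/
noncomputable def crossGram (T S : W → E) (X Y : W) : ℝ :=
  inner ℝ (T X) (S X) * inner ℝ (T Y) (S Y) - inner ℝ (T X) (S Y) ^ 2

theorem crossGram_self_nonneg (T : W → E) (X Y : W) : 0 ≤ crossGram T T X Y := by
  rw [crossGram, sub_nonneg, sq]
  exact real_inner_mul_inner_self_le (T X) (T Y)

theorem crossGram_comm {T S : W → E} (hsym : ∀ X Y, inner ℝ (T X) (S Y) = inner ℝ (T Y) (S X))
    (X Y : W) : crossGram T S X Y = crossGram T S Y X := by
  rw [crossGram, crossGram, hsym X Y, mul_comm]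

theorem crossGram_of_map_right_eq_smul {T S : W → E} {X Z : W} {l : ℝ} {v : E}
    (hZ : T Z = l • v) (hsym : inner ℝ (T X) (S Z) = inner ℝ (T Z) (S X)) :
    crossGram T S X Z
      = l * (inner ℝ (T X) (S X) * inner ℝ v (S Z) - l * inner ℝ v (S X) ^ 2) := by
  rw [crossGram, hsym, hZ, real_inner_smul_left, real_inner_smul_left]
  ring

theorem crossGram_self_of_map_right_eq_smul {T : W → E} {X Z : W} {l : ℝ} {v : E}
    (hZ : T Z = l • v) :
    crossGram T T X Z
      = l ^ 2 * (inner ℝ (T X) (T X) * inner ℝ v v - inner ℝ (T X) v ^ 2) := by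
  simp only [crossGram, hZ, real_inner_smul_left, real_inner_smul_right]
  ring

theorem sq_inner_le_crossGram_self_mul (T : W → E) (X Z : W) (v : E) :
    (inner ℝ (T X) (T X) * inner ℝ (T Z) v - inner ℝ (T Z) (T X) * inner ℝ (T X) v) ^ 2
      ≤ crossGram T T X Z * (inner ℝ (T X) (T X) * inner ℝ v v) := by
  have hcs := real_inner_mul_inner_self_le
    (inner ℝ (T X) (T X) • T Z - inner ℝ (T X) (T Z) • T X) v
  rw [real_inner_self_eq_norm_sq (_ - _), norm_sq_smul_sub_inner_smul, inner_sub_left,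
    real_inner_smul_left, real_inner_smul_left] at hcs
  rw [crossGram, real_inner_comm (T X) (T Z)]
  linarith

theorem mul_sq_inner_le_of_mul_crossGram_self_le {T S : W → E} {X Z : W} {δ : ℝ} (hδ : 0 ≤ δ)
    (h : δ * crossGram T T X Z ≤ crossGram T S X Z) (v : E) :
    δ * (inner ℝ (T X) (T X) * inner ℝ (T Z) v - inner ℝ (T Z) (T X) * inner ℝ (T X) v) ^ 2
      ≤ inner ℝ (T X) (T X) * inner ℝ v v * (inner ℝ (T X) (S X) * inner ℝ (T Z) (S Z)) := by
  have hw : 0 ≤ inner ℝ (T X) (T X) * inner ℝ v v :=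
    mul_nonneg real_inner_self_nonneg real_inner_self_nonneg
  calc _ ≤ δ * (crossGram T T X Z * (inner ℝ (T X) (T X) * inner ℝ v v)) := by
        gcongr
        exact sq_inner_le_crossGram_self_mul T X Z v
    _ = inner ℝ (T X) (T X) * inner ℝ v v * (δ * crossGram T T X Z) := by ring
    _ ≤ _ := by
        exact mul_le_mul_of_nonneg_left (h.trans (sub_le_self _ (sq_nonneg _))) hw

variable [AddCommGroup W] [Module ℝ W]

theorem crossGram_self_pos {T : W →ₗ[ℝ] E} (hT : Function.Injective T) {X Y : W}
    (h : LinearIndependent ℝ ![X, Y]) : 0 < crossGram T T X Y := by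
  have hdet := (Matrix.posDef_gram_of_linearIndependent (𝕜 := ℝ)
    (h.map' T (LinearMap.ker_eq_bot.2 hT))).det_pos
  simpa [Matrix.det_fin_two, Matrix.gram_apply, crossGram, sq, real_inner_comm (T X) (T Y)]
    using hdet

theorem crossGram_eq_zero (T S : W →ₗ[ℝ] E) {X Y : W} (h : ¬ LinearIndependent ℝ ![X, Y]) :
    crossGram T S X Y = 0 := by
  rcases eq_or_ne X 0 with rfl | hX
  · simp [crossGram]
  rw [LinearIndependent.pair_iff' hX] at h
  push Not at h
  obtain ⟨a, rfl⟩ := h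
  simp only [crossGram, map_smul, real_inner_smul_left, real_inner_smul_right]
  ring

variable {T S : W →ₗ[ℝ] E}

theorem crossGram_sub_smul_right (hsym : ∀ X Y, inner ℝ (T X) (S Y) = inner ℝ (T Y) (S X))
    (X Y : W) (s : ℝ) : crossGram T S X (Y - s • X) = crossGram T S X Y := by
  simp only [crossGram, map_sub, map_smul, inner_sub_left, inner_sub_right, real_inner_smul_left,
    real_inner_smul_right, hsym Y X]
  ring

theorem exists_crossGram_eq_of_orthogonal
    (hsym : ∀ X Y, inner ℝ (T X) (S Y) = inner ℝ (T Y) (S X)) (ℓ : W →ₗ[ℝ] ℝ) (X Y : W) :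
    ∃ X' Y', ℓ X' = 0 ∧ inner ℝ (T X') (T Y') = 0 ∧
      crossGram T S X' Y' = crossGram T S X Y ∧ crossGram T T X' Y' = crossGram T T X Y := by
  have hcomm : ∀ X Y, inner ℝ (T X) (T Y) = (inner ℝ (T Y) (T X) : ℝ) := fun _ _ =>
    real_inner_comm _ _
  wlog hX : ℓ X = 0 generalizing X Y
  · set s : ℝ := ℓ Y / ℓ X
    have hs : ℓ (Y - s • X) = 0 := by
      rw [map_sub, map_smul, smul_eq_mul, div_mul_cancel₀ _ hX, sub_self]
    obtain ⟨X', Y', hX', horth, hTS, hTT⟩ := this (Y - s • X) X hs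
    rw [crossGram_comm hsym (_ - _), crossGram_sub_smul_right hsym] at hTS
    rw [crossGram_comm hcomm (_ - _), crossGram_sub_smul_right hcomm] at hTT
    exact ⟨X', Y', hX', horth, hTS, hTT⟩
  refine ⟨X, Y - (inner ℝ (T X) (T Y) / inner ℝ (T X) (T X)) • X, hX, ?_,
    crossGram_sub_smul_right hsym X Y _, crossGram_sub_smul_right hcomm X Y _⟩
  rw [map_sub, map_smul, inner_sub_right, real_inner_smul_right]
  by_cases hTX : T X = 0
  · simp [hTX]
  · rw [div_mul_cancel₀ _ (inner_self_ne_zero.2 hTX), sub_self]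

end CrossGram

section Bound

variable {E : Type*} [NormedAddCommGroup E] [InnerProductSpace ℝ E]

theorem abs_inner_mul_inner_sub_sq_le {x y x' y' : E} {a b l A B R c : ℝ} (ha : 0 ≤ a)
    (hA : 0 ≤ A) (hB : 0 ≤ B) (hR : 0 ≤ R) (hxx' : |inner ℝ x x'| ≤ A * l * a * a)
    (hxy' : |inner ℝ x y'| ≤ A * l * a * b) (hy' : ‖y'‖ ≤ B * b) (hy : l * b ≤ R * ‖y‖)
    (hx : a ≤ c * ‖x‖) :
    |inner ℝ x x' * inner ℝ y y' - inner ℝ x y' ^ 2| ≤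
      (A * B * R + A ^ 2 * R ^ 2) * c ^ 2 * (‖x‖ ^ 2 * ‖y‖ ^ 2) := by
  have hdiag : |inner ℝ x x'| * |inner ℝ y y'| ≤ A * B * R * (a ^ 2 * ‖y‖ ^ 2) := by
    calc _ ≤ (A * l * a * a) * (‖y‖ * (B * b)) :=
          mul_le_mul hxx' ((abs_real_inner_le_norm y y').trans (by gcongr)) (abs_nonneg _)
            ((abs_nonneg _).trans hxx')
      _ = A * B * a ^ 2 * ‖y‖ * (l * b) := by ring
      _ ≤ A * B * a ^ 2 * ‖y‖ * (R * ‖y‖) := by gcongr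
      _ = _ := by ring
  have hoff : |inner ℝ x y'| ≤ A * R * (a * ‖y‖) := by
    calc _ ≤ A * a * (l * b) := hxy'.trans_eq (by ring)
      _ ≤ A * a * (R * ‖y‖) := by gcongr
      _ = _ := by ring
  calc _ ≤ |inner ℝ x x'| * |inner ℝ y y'| + |inner ℝ x y'| ^ 2 := by
        rw [← abs_mul, ← abs_pow]
        exact abs_sub (inner ℝ x x' * inner ℝ y y') (inner ℝ x y' ^ 2)
    _ ≤ A * B * R * (a ^ 2 * ‖y‖ ^ 2) + (A * R * (a * ‖y‖)) ^ 2 := by gcongr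
    _ = (A * B * R + A ^ 2 * R ^ 2) * (a ^ 2 * ‖y‖ ^ 2) := by ring
    _ ≤ (A * B * R + A ^ 2 * R ^ 2) * ((c * ‖x‖) ^ 2 * ‖y‖ ^ 2) := by gcongr
    _ = _ := by ring

theorem norm_sum_smul_le {ι : Type*} [Fintype ι] (a : ι → ℝ) (v : ι → E) {R : ℝ}
    (hR : ∀ i, ‖v i‖ ≤ R) : ‖∑ i, a i • v i‖ ≤ Fintype.card ι * R * ‖a‖ := by
  calc ‖∑ i, a i • v i‖ ≤ ∑ i, ‖a i • v i‖ := norm_sum_le _ _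
    _ ≤ ∑ _i : ι, ‖a‖ * R := by
        gcongr with i
        rw [norm_smul]
        gcongr
        · exact norm_le_pi_norm a i
        · exact hR i
    _ = _ := by
        simp only [Finset.sum_const, Finset.card_univ, nsmul_eq_mul]
        ring

theorem abs_inner_sum_smul_le {ι : Type*} [Fintype ι] (a b : ι → ℝ) (v w : ι → E) {A : ℝ}
    (hA : ∀ i j, |inner ℝ (v i) (w j)| ≤ A) :
    |inner ℝ (∑ i, a i • v i) (∑ j, b j • w j)| ≤ Fintype.card ι ^ 2 * A * ‖a‖ * ‖b‖ := by
  rw [sum_inner]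
  simp only [inner_sum, real_inner_smul_left, real_inner_smul_right]
  calc _ ≤ ∑ i, ∑ j, |b j * (a i * inner ℝ (v i) (w j))| :=
        (Finset.abs_sum_le_sum_abs _ _).trans
          (Finset.sum_le_sum fun _ _ => Finset.abs_sum_le_sum_abs _ _)
    _ ≤ ∑ _i : ι, ∑ _j : ι, ‖b‖ * (‖a‖ * A) := by
        gcongr with i _ j _
        rw [abs_mul, abs_mul]
        gcongr
        · exact norm_le_pi_norm b j
        · exact norm_le_pi_norm a i
        · exact hA i j
    _ = _ := by
        simp only [Finset.sum_const, Finset.card_univ, nsmul_eq_mul]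
        ring

theorem abs_crossGram_le {m : ℕ} {W : Type*} [AddCommGroup W] [Module ℝ W] {T S : W →ₗ[ℝ] E}
    (hm : Module.finrank ℝ E = m + 1) {ν : E [⋀^Fin (m + 1)]→ₗ[ℝ] ℝ}
    (hν : ∀ v : Fin (m + 1) → E, Orthonormal ℝ v → ν v = 1 ∨ ν v = -1)
    (hsym : ∀ X Y, inner ℝ (T X) (S Y) = inner ℝ (T Y) (S X)) (b : Module.Basis (Fin (m + 1)) ℝ W)
    {n : E} {i : Fin (m + 1)} {A B R c : ℝ} (hA : 0 ≤ A) (hc : 0 < c) (hn : ‖n‖ ≤ R)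
    (hTb : ∀ j, ‖T (b j)‖ ≤ R) (hSb : ∀ j, ‖S (b j)‖ ≤ B)
    (hTSb : ∀ j l, |inner ℝ (T (b j)) (S (b l))| ≤ A * |ν fun j => T (b j)|)
    (hcof : c ≤ |ν (Function.update (fun j => T (b j)) i n)|) (X Y : W) :
    |crossGram T S X Y| ≤ (((m + 1) ^ 2 * A) * ((m + 1) * B) * R ^ m
      + ((m + 1) ^ 2 * A) ^ 2 * (R ^ m) ^ 2) * (R ^ m / c) ^ 2 * crossGram T T X Y := by
  have hT : ∀ Z, T Z = ∑ j, b.repr Z j • T (b j) := fun Z => by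
    conv_lhs => rw [← b.sum_repr Z, map_sum]
    simp only [map_smul]
  have hS : ∀ Z, S Z = ∑ j, b.repr Z j • S (b j) := fun Z => by
    conv_lhs => rw [← b.sum_repr Z, map_sum]
    simp only [map_smul]
  have hTS : ∀ Z Z', |inner ℝ (T Z) (S Z')|
      ≤ (m + 1) ^ 2 * A * |ν fun j => T (b j)| * ‖⇑(b.repr Z)‖ * ‖⇑(b.repr Z')‖ := fun Z Z' => by
    rw [hT Z, hS Z']
    refine (abs_inner_sum_smul_le _ _ _ _ hTSb).trans_eq ?_
    rw [Fintype.card_fin]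
    push_cast
    ring
  obtain ⟨X', Y', hX', horth, hXY, hXY'⟩ := exists_crossGram_eq_of_orthogonal hsym (b.coord i) X Y
  have hXc : ‖⇑(b.repr X')‖ ≤ R ^ m / c * ‖T X'‖ := by
    rw [div_mul_eq_mul_div, le_div_iff₀ hc, hT X']
    exact (mul_le_mul_of_nonneg_left hcof (norm_nonneg _)).trans
      (norm_mul_abs_alternatingMap_update_le hm hν hTb hn hX')
  have hR₀ : 0 ≤ R := (norm_nonneg _).trans hn
  have hB₀ : 0 ≤ B := (norm_nonneg _).trans (hSb 0)
  rw [← hXY, ← hXY', crossGram, crossGram, horth, real_inner_self_eq_norm_sq,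
    real_inner_self_eq_norm_sq, zero_pow two_ne_zero, sub_zero]
  refine abs_inner_mul_inner_sub_sq_le (norm_nonneg _) (by positivity) (by positivity)
    (by positivity) (hTS X' X') (hTS X' Y') ?_ ?_ hXc
  · rw [hS]
    exact (norm_sum_smul_le _ _ hSb).trans_eq (by simp)
  · rw [hT Y', mul_comm]
    exact norm_mul_abs_alternatingMap_le hm hν hTb _

end Bound

theorem finrank_fiber {M F : Type*} [TopologicalSpace M] [NormedAddCommGroup F] [NormedSpace ℝ F]
    {V : M → Type*} [TopologicalSpace (TotalSpace F V)] [∀ x, NormedAddCommGroup (V x)]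
    [∀ x, NormedSpace ℝ (V x)] [FiberBundle F V] [VectorBundle ℝ F V] (x : M) :
    Module.finrank ℝ (V x) = Module.finrank ℝ F :=
  ((trivializationAt F V x).continuousLinearEquivAt ℝ x
    (mem_baseSet_trivializationAt F V x)).toLinearEquiv.finrank_eq

section SmoothSections

variable {k : ℕ} {M : Type*} [TopologicalSpace M]
  [ChartedSpace (EuclideanSpace ℝ (Fin (k + 1))) M] {p : M}

/-- Smoothness of the section `s` of a vector bundle with fibre `F` at the point `p`. -/
abbrev SmoothSectionAt (k : ℕ) {M : Type*} [TopologicalSpace M]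
    [ChartedSpace (EuclideanSpace ℝ (Fin (k + 1))) M] (F : Type*) [NormedAddCommGroup F]
    [NormedSpace ℝ F] {V : M → Type*} [TopologicalSpace (TotalSpace F V)]
    [∀ x, TopologicalSpace (V x)] [FiberBundle F V] (s : ∀ x : M, V x) (p : M) : Prop :=
  ContMDiffAt (𝓡 (k + 1)) ((𝓡 (k + 1)).prod 𝓘(ℝ, F)) ∞ (fun y => TotalSpace.mk' F y (s y)) p

variable {F : Type*} [NormedAddCommGroup F] [NormedSpace ℝ F]
  {V : M → Type*} [TopologicalSpace (TotalSpace F V)]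
  [∀ x, NormedAddCommGroup (V x)] [FiberBundle F V]

theorem exists_smoothSectionAt_eq (v : V p) :
    ∃ s : ∀ x : M, V x, SmoothSectionAt k F s p ∧ s p = v :=
  ⟨FiberBundle.extend F v, FiberBundle.contMDiffAt_extend (k := ∞) (𝓡 (k + 1)) F v, by simp⟩

variable [∀ x, InnerProductSpace ℝ (V x)] {μ : ∀ x : M, V x [⋀^Fin (k + 1)]→ₗ[ℝ] ℝ}

theorem IsCoorientation.contMDiffAt_update (hμ : IsCoorientation F μ)
    {s : Fin (k + 1) → ∀ x : M, V x} (hs : ∀ j, SmoothSectionAt k F (s j) p) {n : ∀ x : M, V x}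
    (hn : SmoothSectionAt k F n p) (i : Fin (k + 1)) :
    ContMDiffAt (𝓡 (k + 1)) 𝓘(ℝ, ℝ) ∞
      (fun x => μ x (Function.update (fun j => s j x) i (n x))) p := by
  have hupdate : ∀ x, Function.update (fun j => s j x) i (n x)
      = fun j => Function.update s i n j x := fun x => by
    funext j
    rcases eq_or_ne j i with rfl | hj
    · simp
    · simp [hj]
  simp only [hupdate]
  refine hμ.smooth _ p fun j => ?_
  rcases eq_or_ne j i with rfl | hj
  · rwa [Function.update_self]
  · rw [Function.update_of_ne hj]
    exact hs j

variable [VectorBundle ℝ F V]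

theorem injective_iff_surjective_of_finrank_eq (h : Module.finrank ℝ F = k + 1)
    (T : TangentSpace (𝓡 (k + 1)) p →L[ℝ] V p) :
    Function.Injective T ↔ Function.Surjective T := by
  have hV := (finrank_fiber (V := V) p).trans h
  have : FiniteDimensional ℝ (V p) := .of_finrank_eq_succ hV
  have : FiniteDimensional ℝ (TangentSpace (𝓡 (k + 1)) p) :=
    inferInstanceAs (FiniteDimensional ℝ (EuclideanSpace ℝ (Fin (k + 1))))
  have hT : Module.finrank ℝ (TangentSpace (𝓡 (k + 1)) p) = k + 1 :=
    finrank_euclideanSpace_fin (𝕜 := ℝ)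
  exact LinearMap.injective_iff_surjective_of_finrank_eq_finrank (f := T.toLinearMap)
    (hT.trans hV.symm)

theorem exists_map_eq_zero_of_mem_singularSet (h : Module.finrank ℝ F = k + 1)
    {φ : ∀ x : M, TangentSpace (𝓡 (k + 1)) x →L[ℝ] V x} (hp : p ∈ singularSet φ) :
    ∃ Z : TangentSpace (𝓡 (k + 1)) p, Z ≠ 0 ∧ φ p Z = 0 := by
  by_contra! H
  have hinj : Function.Injective (φ p) :=
    (injective_iff_map_eq_zero _).2 fun Z hZ => by_contra fun hne => H Z hne hZ
  exact hp ⟨hinj, (injective_iff_surjective_of_finrank_eq h _).1 hinj⟩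

section Riemannian

variable [IsContMDiffRiemannianBundle (𝓡 (k + 1)) ∞ F V]

theorem eventually_norm_le_add_one {s : ∀ x : M, V x} (hs : SmoothSectionAt k F s p) :
    ∀ᶠ q in 𝓝 p, ‖s q‖ ≤ ‖s p‖ + 1 := by
  have hnorm : ContinuousAt (fun q => ‖s q‖) p := by
    simpa only [norm_eq_sqrt_real_inner] using (ContMDiffAt.inner_bundle hs hs).continuousAt.sqrt
  exact hnorm.eventually_le_const (lt_add_one _)

theorem exists_eventually_norm_le {ι : Type*} [Finite ι] {s : ι → ∀ x : M, V x}
    (hs : ∀ i, SmoothSectionAt k F (s i) p) : ∃ R : ℝ, ∀ᶠ q in 𝓝 p, ∀ i, ‖s i q‖ ≤ R := by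
  obtain ⟨R, hR⟩ := (Set.finite_range fun i => ‖s i p‖ + 1).bddAbove
  refine ⟨R, eventually_all.2 fun i => ?_⟩
  filter_upwards [eventually_norm_le_add_one (hs i)] with q hq
  exact hq.trans (hR (mem_range_self i))

end Riemannian

end SmoothSections

section TangentFields

variable {k : ℕ} {M : Type*} [TopologicalSpace M]
  [ChartedSpace (EuclideanSpace ℝ (Fin (k + 1))) M] {p : M}
  {o : ∀ x : M, Orientation ℝ (TangentSpace (𝓡 (k + 1)) x) (Fin (k + 1))}
  {e : OpenPartialHomeomorph M (EuclideanSpace ℝ (Fin (k + 1)))}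

theorem IsPositiveChart.exists_basis (he : IsPositiveChart o e) {x : M} (hx : x ∈ e.source) :
    ∃ b : Module.Basis (Fin (k + 1)) ℝ (TangentSpace (𝓡 (k + 1)) x),
      (∀ j, b j = coordVec e j x) ∧ b.orientation = o x := by
  obtain ⟨b, hb, hbo⟩ := he.2 x hx
  exact ⟨b, congrFun hb, hbo⟩

variable [IsManifold (𝓡 (k + 1)) ∞ M]

/-- Smoothness of the vector field `X` at the point `p`. -/
abbrev SmoothFieldAt (X : ∀ x : M, TangentSpace (𝓡 (k + 1)) x) (p : M) : Prop :=
  ContMDiffAt (𝓡 (k + 1)) ((𝓡 (k + 1)).prod 𝓘(ℝ, EuclideanSpace ℝ (Fin (k + 1)))) ∞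
    (fun y => TotalSpace.mk' (EuclideanSpace ℝ (Fin (k + 1))) y (X y)) p

theorem exists_smoothFieldAt_eq (X₀ : TangentSpace (𝓡 (k + 1)) p) :
    ∃ X : ∀ x : M, TangentSpace (𝓡 (k + 1)) x, SmoothFieldAt X p ∧ X p = X₀ :=
  ⟨FiberBundle.extend (EuclideanSpace ℝ (Fin (k + 1))) X₀,
    FiberBundle.contMDiffAt_extend (k := ∞) (𝓡 (k + 1)) _ X₀, by simp⟩

theorem IsPositiveChart.smoothFieldAt_coordVec (he : IsPositiveChart o e) (hp : p ∈ e.source)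
    (j : Fin (k + 1)) : SmoothFieldAt (coordVec e j) p := by
  obtain ⟨b, hb, -⟩ := he.exists_basis hp
  have hinv : (mfderiv (𝓡 (k + 1)) (𝓡 (k + 1)) e p).IsInvertible := by
    by_contra h
    refine b.ne_zero j ((hb j).trans ?_)
    change (mfderiv (𝓡 (k + 1)) (𝓡 (k + 1)) e p).inverse _ = 0
    rw [ContinuousLinearMap.inverse_of_not_isInvertible h]
    rfl
  have hconst : ContMDiffAt (𝓡 (k + 1)) (𝓡 (k + 1)).tangent ∞
      (fun y => (⟨y, EuclideanSpace.single j (1 : ℝ)⟩ :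
        TangentBundle (𝓡 (k + 1)) (EuclideanSpace ℝ (Fin (k + 1))))) (e p) :=
    contMDiffAt_vectorSpace_iff_contDiffAt.2 contDiffAt_const
  have : IsManifold (𝓡 (k + 1)) 1 M := .of_le (n := ∞) (by simp)
  exact hconst.mpullback_vectorField_preimage (contMDiffAt_of_mem_maximalAtlas he.1 hp) hinv
    (by simp)

theorem eventually_continuousAt_of_contMDiffAt {f : M → ℝ}
    (hf : ContMDiffAt (𝓡 (k + 1)) 𝓘(ℝ, ℝ) ∞ f p) : ∀ᶠ q in 𝓝 p, ContinuousAt f q := by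
  have : IsManifold (𝓡 (k + 1)) 1 M := .of_le (n := ∞) (by simp)
  have hf₁ : ContMDiffAt (𝓡 (k + 1)) 𝓘(ℝ, ℝ) 1 f p := hf.of_le (by simp)
  filter_upwards [(contMDiffAt_iff_contMDiffAt_nhds (by simp)).1 hf₁] with q hq
  exact hq.continuousAt

end TangentFields

section Cofactor

variable {k : ℕ} {M : Type*} [TopologicalSpace M]
  [ChartedSpace (EuclideanSpace ℝ (Fin (k + 1))) M] {p : M}
  {V : M → Type*} [∀ x, NormedAddCommGroup (V x)] [∀ x, InnerProductSpace ℝ (V x)]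

/-- The vector field of coordinate cofactors of `φ` along a section `n`. It is a smooth extension
of a null direction to regular points: `φ` maps it to `λ_φ n`. -/
noncomputable def cofactorField (μ : ∀ x : M, V x [⋀^Fin (k + 1)]→ₗ[ℝ] ℝ)
    (φ : ∀ x : M, TangentSpace (𝓡 (k + 1)) x →L[ℝ] V x)
    (e : OpenPartialHomeomorph M (EuclideanSpace ℝ (Fin (k + 1)))) (n : ∀ x : M, V x)
    (x : M) : TangentSpace (𝓡 (k + 1)) x :=
  cofactorVec (μ x) (fun j => coordVec e j x) (φ x).toLinearMap (n x)

variable {F : Type*} [NormedAddCommGroup F] [NormedSpace ℝ F] [TopologicalSpace (TotalSpace F V)]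
  [FiberBundle F V] [VectorBundle ℝ F V]
  {o : ∀ x : M, Orientation ℝ (TangentSpace (𝓡 (k + 1)) x) (Fin (k + 1))}
  {μ : ∀ x : M, V x [⋀^Fin (k + 1)]→ₗ[ℝ] ℝ}
  {φ : ∀ x : M, TangentSpace (𝓡 (k + 1)) x →L[ℝ] V x}
  {e : OpenPartialHomeomorph M (EuclideanSpace ℝ (Fin (k + 1)))}

theorem map_cofactorField (h : Module.finrank ℝ F = k + 1) (n : ∀ x : M, V x) (x : M) :
    φ x (cofactorField μ φ e n x) = jacobian μ φ e x • n x := by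
  have hV := (finrank_fiber (V := V) x).trans h
  have : FiniteDimensional ℝ (V x) := .of_finrank_eq_succ hV
  exact map_cofactorVec (Module.finBasisOfFinrankEq ℝ (V x) hV) (μ x) _ (φ x).toLinearMap (n x)

theorem IsPositiveChart.mem_singularSet_iff (h : Module.finrank ℝ F = k + 1)
    (hμ : IsCoorientation F μ) (he : IsPositiveChart o e) {x : M} (hx : x ∈ e.source) :
    x ∈ singularSet φ ↔ jacobian μ φ e x = 0 := by
  obtain ⟨b, hb, -⟩ := he.exists_basis hx
  have hbij := alternatingMap_comp_basis_ne_zero_iff ((finrank_fiber x).trans h) (hμ.unit x) b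
    (φ x).toLinearMap
  simp only [hb] at hbij
  exact (not_congr hbij).symm.trans not_not

theorem IsPositiveChart.exists_eq_smul_cofactorField (he : IsPositiveChart o e)
    (hp : p ∈ e.source) {n : ∀ x : M, V x} (hne : cofactorField μ φ e n p ≠ 0)
    {Z : TangentSpace (𝓡 (k + 1)) p} (hZ : φ p Z = 0) :
    ∃ r : ℝ, Z = r • cofactorField μ φ e n p := by
  obtain ⟨b, hb, -⟩ := he.exists_basis hp
  have hcof : cofactorField μ φ e n p = cofactorVec (μ p) b (φ p).toLinearMap (n p) := by
    simp only [cofactorField, cofactorVec, hb]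
  rw [hcof] at hne ⊢
  exact exists_eq_smul_cofactorVec (μ p) b hne hZ

end Cofactor

section CoherentTangentBundle

variable {k : ℕ} {M : Type*} [TopologicalSpace M]
  [ChartedSpace (EuclideanSpace ℝ (Fin (k + 1))) M] [IsManifold (𝓡 (k + 1)) ∞ M]
  {F : Type*} [NormedAddCommGroup F] [NormedSpace ℝ F] [FiniteDimensional ℝ F]
  {V : M → Type*} [TopologicalSpace (TotalSpace F V)]
  [∀ x, NormedAddCommGroup (V x)] [∀ x, InnerProductSpace ℝ (V x)]
  [FiberBundle F V] [VectorBundle ℝ F V] [ContMDiffVectorBundle ∞ F V (𝓡 (k + 1))]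
  [IsContMDiffRiemannianBundle (𝓡 (k + 1)) ∞ F V]
  {o : ∀ x : M, Orientation ℝ (TangentSpace (𝓡 (k + 1)) x) (Fin (k + 1))}
  {μ : ∀ x : M, V x [⋀^Fin (k + 1)]→ₗ[ℝ] ℝ}
  {D : CovariantDerivative (𝓡 (k + 1)) F V}
  {φ : ∀ x : M, TangentSpace (𝓡 (k + 1)) x →L[ℝ] V x}
  {e : OpenPartialHomeomorph M (EuclideanSpace ℝ (Fin (k + 1)))} {p : M}

namespace IsCoherentTangentBundle

theorem smoothSectionAt_apply (h : IsCoherentTangentBundle D φ)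
    {X : ∀ x : M, TangentSpace (𝓡 (k + 1)) x} (hX : SmoothFieldAt X p) :
    SmoothSectionAt k F (fun x => φ x (X x)) p :=
  (h.smooth_hom p).clm_bundle_apply hX

theorem contMDiffAt_jacobian (h : IsCoherentTangentBundle D φ) (hμ : IsCoorientation F μ)
    (he : IsPositiveChart o e) (hp : p ∈ e.source) :
    ContMDiffAt (𝓡 (k + 1)) 𝓘(ℝ, ℝ) ∞ (jacobian μ φ e) p :=
  hμ.smooth _ p fun j => h.smoothSectionAt_apply (he.smoothFieldAt_coordVec hp j)

theorem smoothFieldAt_cofactorField (h : IsCoherentTangentBundle D φ) (hμ : IsCoorientation F μ)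
    (he : IsPositiveChart o e) (hp : p ∈ e.source) {n : ∀ x : M, V x}
    (hn : SmoothSectionAt k F n p) : SmoothFieldAt (cofactorField μ φ e n) p := by
  have hφe (j) := h.smoothSectionAt_apply (he.smoothFieldAt_coordVec hp j)
  unfold cofactorField cofactorVec
  exact ContMDiffAt.sum_section fun i _ =>
    (hμ.contMDiffAt_update hφe hn i).smul_section (he.smoothFieldAt_coordVec hp i)

theorem mvfderiv_inner (h : IsCoherentTangentBundle D φ) {s t : ∀ x : M, V x}
    (hs : SmoothSectionAt k F s p) (ht : SmoothSectionAt k F t p)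
    (v : TangentSpace (𝓡 (k + 1)) p) :
    mvfderiv (𝓡 (k + 1)) (fun x => inner ℝ (s x) (t x)) p v =
      inner ℝ (D s p v) (t p) + inner ℝ (s p) (D t p v) := by
  obtain ⟨X, -, rfl⟩ := exists_smoothFieldAt_eq v
  exact h.metric.mvfderiv_inner_eq X (hs.mdifferentiableAt (by simp))
    (ht.mdifferentiableAt (by simp))

theorem exists_connection_swap (h : IsCoherentTangentBundle D φ)
    {X Y : ∀ x : M, TangentSpace (𝓡 (k + 1)) x} (hX : SmoothFieldAt X p)
    (hY : SmoothFieldAt Y p) :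
    ∃ z, D (fun y => φ y (X y)) p (Y p) = D (fun y => φ y (Y y)) p (X p) + φ p z := by
  refine ⟨-VectorField.mlieBracket (𝓡 (k + 1)) X Y p, ?_⟩
  have htorsion := h.coherent p X Y (hX.mdifferentiableAt (by simp))
    (hY.mdifferentiableAt (by simp))
  rw [sub_sub, sub_eq_zero] at htorsion
  rw [htorsion, map_neg]
  abel

end IsCoherentTangentBundle

end CoherentTangentBundle

section NullLift

variable {k : ℕ} {M : Type*} [TopologicalSpace M]
  [ChartedSpace (EuclideanSpace ℝ (Fin (k + 1))) M] [IsManifold (𝓡 (k + 1)) ∞ M]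

/-- Local data `lam, n, η` at `p` with `φ(η) = lam n`, where the function `lam` defines the
singular set. This smooth extension of a null field is what makes the first and second
fundamental forms computable up to the singular set; the main example is
`IsPositiveChart.isNullLift`. -/
structure IsNullLift (F : Type*) [NormedAddCommGroup F] [NormedSpace ℝ F]
    {V : M → Type*} [TopologicalSpace (TotalSpace F V)]
    [∀ x, NormedAddCommGroup (V x)] [∀ x, InnerProductSpace ℝ (V x)] [FiberBundle F V]
    (φ : ∀ x : M, TangentSpace (𝓡 (k + 1)) x →L[ℝ] V x) (p : M)
    (lam : M → ℝ) (n : ∀ x : M, V x) (η : ∀ x : M, TangentSpace (𝓡 (k + 1)) x) : Prop where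
  contMDiffAt_lam : ContMDiffAt (𝓡 (k + 1)) 𝓘(ℝ, ℝ) ∞ lam p
  smoothSectionAt : SmoothSectionAt k F n p
  smoothFieldAt : SmoothFieldAt η p
  mem_singularSet_iff : ∀ᶠ q in 𝓝 p, q ∈ singularSet φ ↔ lam q = 0
  map_field : ∀ᶠ q in 𝓝 p, φ q (η q) = lam q • n q

variable {F : Type*} [NormedAddCommGroup F] [NormedSpace ℝ F]
  {V : M → Type*} [TopologicalSpace (TotalSpace F V)]
  [∀ x, NormedAddCommGroup (V x)] [∀ x, InnerProductSpace ℝ (V x)] [FiberBundle F V]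
  {φ : ∀ x : M, TangentSpace (𝓡 (k + 1)) x →L[ℝ] V x}
  {p : M} {lam : M → ℝ} {n : ∀ x : M, V x} {η : ∀ x : M, TangentSpace (𝓡 (k + 1)) x}

namespace IsNullLift

theorem lam_eq_zero (h : IsNullLift F φ p lam n η) (hp : p ∈ singularSet φ) : lam p = 0 :=
  h.mem_singularSet_iff.self_of_nhds.1 hp

theorem map_field_eq_zero (h : IsNullLift F φ p lam n η) (hp : p ∈ singularSet φ) :
    φ p (η p) = 0 := by
  rw [h.map_field.self_of_nhds, h.lam_eq_zero hp, zero_smul]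

variable [FiniteDimensional ℝ F] [VectorBundle ℝ F V]
  [ContMDiffVectorBundle ∞ F V (𝓡 (k + 1))] [IsContMDiffRiemannianBundle (𝓡 (k + 1)) ∞ F V]
  {D : CovariantDerivative (𝓡 (k + 1)) F V}

theorem connection_map_field (h : IsNullLift F φ p lam n η) (hφ : IsCoherentTangentBundle D φ)
    (hp : p ∈ singularSet φ) (v : TangentSpace (𝓡 (k + 1)) p) :
    D (fun y => φ y (η y)) p v = mvfderiv (𝓡 (k + 1)) lam p v • n p := by
  have hlam_n : SmoothSectionAt k F (lam • n) p := h.contMDiffAt_lam.smul_section h.smoothSectionAt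
  have hD := D.isCovariantDerivativeOn (s := univ) |>.congr_of_eventuallyEq
    ((hφ.smoothSectionAt_apply h.smoothFieldAt).mdifferentiableAt (by simp))
    (hlam_n.mdifferentiableAt (by simp)) univ_mem h.map_field
  rw [hD, D.isCovariantDerivativeOn.leibniz (h.smoothSectionAt.mdifferentiableAt (by simp))
    (h.contMDiffAt_lam.mdifferentiableAt (by simp)), h.lam_eq_zero hp]
  simp

theorem mvfderiv_field_comm {lam' : M → ℝ} {η' : ∀ x : M, TangentSpace (𝓡 (k + 1)) x}
    (h : IsNullLift F φ p lam n η) (h' : IsNullLift F φ p lam' n η')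
    (hφ : IsCoherentTangentBundle D φ) (hp : p ∈ singularSet φ) (hn : ∀ z, φ p z ≠ n p) :
    mvfderiv (𝓡 (k + 1)) lam p (η' p) = mvfderiv (𝓡 (k + 1)) lam' p (η p) := by
  obtain ⟨z, hz⟩ := hφ.exists_connection_swap h.smoothFieldAt h'.smoothFieldAt
  rw [h.connection_map_field hφ hp, h'.connection_map_field hφ hp, ← sub_eq_iff_eq_add',
    ← sub_smul] at hz
  by_contra hne
  exact hn _ (by rw [map_smul, ← hz, inv_smul_smul₀ (sub_ne_zero.2 hne)])

theorem field_ne_zero (h : IsNullLift F φ p lam n η) (hφ : IsCoherentTangentBundle D φ)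
    (hp : p ∈ singularSet φ) (hd : mvfderiv (𝓡 (k + 1)) lam p ≠ 0) (hn : ∀ z, φ p z ≠ n p) :
    η p ≠ 0 := by
  intro hη
  obtain ⟨w, hw⟩ := ContinuousLinearMap.exists_ne_zero hd
  obtain ⟨X, hX, rfl⟩ := exists_smoothFieldAt_eq w
  obtain ⟨z, hz⟩ := hφ.exists_connection_swap h.smoothFieldAt hX
  rw [h.connection_map_field hφ hp, hη, map_zero, zero_add] at hz
  apply hn ((mvfderiv (𝓡 (k + 1)) lam p (X p))⁻¹ • z)
  rw [map_smul, ← hz, inv_smul_smul₀ hw]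

end IsNullLift

theorem IsPositiveChart.isNullLift [FiniteDimensional ℝ F]
    [VectorBundle ℝ F V] [ContMDiffVectorBundle ∞ F V (𝓡 (k + 1))]
    [IsContMDiffRiemannianBundle (𝓡 (k + 1)) ∞ F V] {D : CovariantDerivative (𝓡 (k + 1)) F V}
    {o : ∀ x : M, Orientation ℝ (TangentSpace (𝓡 (k + 1)) x) (Fin (k + 1))}
    {μ : ∀ x : M, V x [⋀^Fin (k + 1)]→ₗ[ℝ] ℝ}
    {e : OpenPartialHomeomorph M (EuclideanSpace ℝ (Fin (k + 1)))}
    (hφ : IsCoherentTangentBundle D φ) (hμ : IsCoorientation F μ) (he : IsPositiveChart o e)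
    (hp : p ∈ e.source) (hn : SmoothSectionAt k F n p) :
    IsNullLift F φ p (jacobian μ φ e) n (cofactorField μ φ e n) where
  contMDiffAt_lam := hφ.contMDiffAt_jacobian hμ he hp
  smoothSectionAt := hn
  smoothFieldAt := hφ.smoothFieldAt_cofactorField hμ he hp hn
  mem_singularSet_iff := by
    filter_upwards [e.open_source.mem_nhds hp] with q hq
    exact he.mem_singularSet_iff hφ.rank_eq hμ hq
  map_field := .of_forall fun q => map_cofactorField hφ.rank_eq n q

end NullLift

section ExtrinsicCurvature

theorem abs_sub_le_of_abs_crossGram_le {W E : Type*} [NormedAddCommGroup E] [InnerProductSpace ℝ E]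
    {T S : W → E} {X Z : W} {l C : ℝ} {v : E} (hl : l ≠ 0) (hZ : T Z = l • v)
    (hsym : inner ℝ (T X) (S Z) = inner ℝ (T Z) (S X))
    (h : |crossGram T S X Z| ≤ C * crossGram T T X Z) :
    |inner ℝ (T X) (S X) * inner ℝ v (S Z) - l * inner ℝ v (S X) ^ 2|
      ≤ C * (|l| * (inner ℝ (T X) (T X) * inner ℝ v v - inner ℝ (T X) v ^ 2)) := by
  rw [crossGram_of_map_right_eq_smul hZ hsym, crossGram_self_of_map_right_eq_smul hZ, abs_mul,
    ← sq_abs l] at h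
  refine le_of_mul_le_mul_left (h.trans_eq ?_) (abs_pos.2 hl)
  ring

variable {k : ℕ} {M : Type*} [TopologicalSpace M]
  [ChartedSpace (EuclideanSpace ℝ (Fin (k + 1))) M]
  {V : M → Type*} [∀ x, NormedAddCommGroup (V x)] [∀ x, InnerProductSpace ℝ (V x)]
  {φ ψ : ∀ x : M, TangentSpace (𝓡 (k + 1)) x →L[ℝ] V x} {x : M}
  {X Y : TangentSpace (𝓡 (k + 1)) x} {c : ℝ}

theorem extCurv_eq_crossGram_div (φ ψ : ∀ x : M, TangentSpace (𝓡 (k + 1)) x →L[ℝ] V x) (x : M)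
    (X Y : TangentSpace (𝓡 (k + 1)) x) :
    extCurv φ ψ x X Y = crossGram (φ x) (ψ x) X Y / crossGram (φ x) (φ x) X Y := by
  simp only [extCurv, formI, formII, crossGram, neg_mul_neg, neg_sq]

theorem crossGram_self_pos_of_notMem_singularSet (hx : x ∉ singularSet φ)
    (h : LinearIndependent ℝ ![X, Y]) : 0 < crossGram (φ x) (φ x) X Y :=
  crossGram_self_pos (T := (φ x).toLinearMap) (not_not.1 hx).1 h

theorem mul_crossGram_self_le_of_le_extCurv (hx : x ∉ singularSet φ)
    (h : LinearIndependent ℝ ![X, Y] → c ≤ extCurv φ ψ x X Y) :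
    c * crossGram (φ x) (φ x) X Y ≤ crossGram (φ x) (ψ x) X Y := by
  by_cases hXY : LinearIndependent ℝ ![X, Y]
  · rw [← le_div_iff₀ (crossGram_self_pos_of_notMem_singularSet hx hXY), ← extCurv_eq_crossGram_div]
    exact h hXY
  · have hzero (T : TangentSpace (𝓡 (k + 1)) x →L[ℝ] V x) : crossGram (φ x) T X Y = 0 :=
      crossGram_eq_zero (φ x).toLinearMap T.toLinearMap hXY
    rw [hzero, hzero, mul_zero]

theorem crossGram_le_mul_of_extCurv_le (hx : x ∉ singularSet φ)
    (h : LinearIndependent ℝ ![X, Y] → extCurv φ ψ x X Y ≤ c) :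
    crossGram (φ x) (ψ x) X Y ≤ c * crossGram (φ x) (φ x) X Y := by
  by_cases hXY : LinearIndependent ℝ ![X, Y]
  · rw [← div_le_iff₀ (crossGram_self_pos_of_notMem_singularSet hx hXY), ← extCurv_eq_crossGram_div]
    exact h hXY
  · have hzero (T : TangentSpace (𝓡 (k + 1)) x →L[ℝ] V x) : crossGram (φ x) T X Y = 0 :=
      crossGram_eq_zero (φ x).toLinearMap T.toLinearMap hXY
    rw [hzero, hzero, mul_zero]

theorem abs_extCurv_le_of_abs_crossGram_le (hx : x ∉ singularSet φ)
    (hXY : LinearIndependent ℝ ![X, Y])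
    (h : |crossGram (φ x) (ψ x) X Y| ≤ c * crossGram (φ x) (φ x) X Y) :
    |extCurv φ ψ x X Y| ≤ c := by
  have hpos := crossGram_self_pos_of_notMem_singularSet hx hXY
  rwa [extCurv_eq_crossGram_div, abs_div, abs_of_pos hpos, div_le_iff₀ hpos]

namespace ExtCurvOn

variable {U : Set M}

theorem crossGram_nonneg (h : ExtCurvOn φ ψ U (fun c => 0 ≤ c)) (hx : x ∈ U \ singularSet φ)
    (X Y : TangentSpace (𝓡 (k + 1)) x) : 0 ≤ crossGram (φ x) (ψ x) X Y := by
  simpa using mul_crossGram_self_le_of_le_extCurv hx.2 (h x hx X Y)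

theorem crossGram_nonpos (h : ExtCurvOn φ ψ U (fun c => c ≤ 0)) (hx : x ∈ U \ singularSet φ)
    (X Y : TangentSpace (𝓡 (k + 1)) x) : crossGram (φ x) (ψ x) X Y ≤ 0 := by
  simpa using crossGram_le_mul_of_extCurv_le hx.2 (h x hx X Y)

theorem abs_crossGram_le {C : ℝ} (h : ExtCurvOn φ ψ U (fun c => |c| ≤ C))
    (hx : x ∈ U \ singularSet φ) (X Y : TangentSpace (𝓡 (k + 1)) x) :
    |crossGram (φ x) (ψ x) X Y| ≤ C * crossGram (φ x) (φ x) X Y := by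
  refine abs_le.2 ⟨?_, crossGram_le_mul_of_extCurv_le hx.2 fun hXY =>
    (abs_le.1 (h x hx X Y hXY)).2⟩
  rw [← neg_mul]
  exact mul_crossGram_self_le_of_le_extCurv hx.2 fun hXY => (abs_le.1 (h x hx X Y hXY)).1

end ExtCurvOn

end ExtrinsicCurvature

section FrontBundle

variable {k : ℕ} {M : Type*} [TopologicalSpace M]
  [ChartedSpace (EuclideanSpace ℝ (Fin (k + 1))) M] [IsManifold (𝓡 (k + 1)) ∞ M]
  {F : Type*} [NormedAddCommGroup F] [NormedSpace ℝ F]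
  {V : M → Type*} [TopologicalSpace (TotalSpace F V)]
  [∀ x, NormedAddCommGroup (V x)] [∀ x, InnerProductSpace ℝ (V x)] [FiberBundle F V]
  {φ : ∀ x : M, TangentSpace (𝓡 (k + 1)) x →L[ℝ] V x}
  {p : M} {lam : M → ℝ} {n : ∀ x : M, V x} {η : ∀ x : M, TangentSpace (𝓡 (k + 1)) x}

theorem IsNullLift.neBot_nhdsWithin_compl_singularSet (h : IsNullLift F φ p lam n η)
    (hp : p ∈ singularSet φ) (hd : mvfderiv (𝓡 (k + 1)) lam p ≠ 0) :
    (𝓝[(singularSet φ)ᶜ] p).NeBot := by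
  obtain ⟨v, hv⟩ := ContinuousLinearMap.exists_ne_zero hd
  obtain ⟨l, hl, hlp, hlam, -⟩ := exists_filter_tendsto_div
    (h.contMDiffAt_lam.mdifferentiableAt (by simp)) (h.lam_eq_zero hp) hv
  refine hl.mono (le_inf hlp (le_principal_iff.2 ?_))
  filter_upwards [hlam, hlp h.mem_singularSet_iff] with q hq hiff
  exact mt hiff.1 hq

variable [FiniteDimensional ℝ F] [VectorBundle ℝ F V]
  [ContMDiffVectorBundle ∞ F V (𝓡 (k + 1))] [IsContMDiffRiemannianBundle (𝓡 (k + 1)) ∞ F V]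
  {D : CovariantDerivative (𝓡 (k + 1)) F V}
  {ψ : ∀ x : M, TangentSpace (𝓡 (k + 1)) x →L[ℝ] V x}
  {o : ∀ x : M, Orientation ℝ (TangentSpace (𝓡 (k + 1)) x) (Fin (k + 1))}
  {μ : ∀ x : M, V x [⋀^Fin (k + 1)]→ₗ[ℝ] ℝ}
  {e : OpenPartialHomeomorph M (EuclideanSpace ℝ (Fin (k + 1)))}
  {X Y : ∀ x : M, TangentSpace (𝓡 (k + 1)) x} {U : Set M}

namespace IsFrontBundle

theorem inner_eq_zero_of_forall_self (h : IsFrontBundle D φ ψ) {x : M}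
    {X Y : TangentSpace (𝓡 (k + 1)) x} (hX : inner ℝ (φ x X) (ψ x X) = 0)
    (hY : inner ℝ (φ x Y) (ψ x Y) = 0)
    (hXY : inner ℝ (φ x (X + Y)) (ψ x (X + Y)) = 0) : inner ℝ (φ x X) (ψ x Y) = 0 := by
  simp only [map_add, inner_add_left, inner_add_right, hX, hY, h.compatible x Y X] at hXY
  linarith

theorem contMDiffAt_inner_apply (h : IsFrontBundle D φ ψ) (hX : SmoothFieldAt X p)
    (hY : SmoothFieldAt Y p) :
    ContMDiffAt (𝓡 (k + 1)) 𝓘(ℝ, ℝ) ∞ (fun x => inner ℝ (φ x (X x)) (ψ x (Y x))) p :=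
  (h.coherent_fst.smoothSectionAt_apply hX).inner_bundle (h.coherent_snd.smoothSectionAt_apply hY)

theorem inner_self_eq_zero_of_abs_crossGram_le (h : IsFrontBundle D φ ψ)
    (hη : IsNullLift F φ p lam n η) (hp : p ∈ singularSet φ)
    (hd : mvfderiv (𝓡 (k + 1)) lam p ≠ 0) (hρ : inner ℝ (n p) (ψ p (η p)) ≠ 0)
    (hX : SmoothFieldAt X p) {C : ℝ} (hC : ∀ᶠ q in 𝓝[(singularSet φ)ᶜ] p,
      |crossGram (φ q) (ψ q) (X q) (η q)| ≤ C * crossGram (φ q) (φ q) (X q) (η q)) :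
    inner ℝ (φ p (X p)) (ψ p (X p)) = 0 := by
  have := hη.neBot_nhdsWithin_compl_singularSet hp hd
  have hn := hη.smoothSectionAt
  have hφX := h.coherent_fst.smoothSectionAt_apply hX
  have hψX := h.coherent_snd.smoothSectionAt_apply hX
  have hψη := h.coherent_snd.smoothSectionAt_apply hη.smoothFieldAt
  have hlam := hη.contMDiffAt_lam.continuousAt
  have hleft := (((hφX.inner_bundle hψX).continuousAt.mul (hn.inner_bundle hψη).continuousAt).sub
    (hlam.mul ((hn.inner_bundle hψX).continuousAt.pow 2))).abs
  have hright := (hlam.abs.mul (((hφX.inner_bundle hφX).continuousAt.mul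
    (hn.inner_bundle hn).continuousAt).sub ((hφX.inner_bundle hn).continuousAt.pow 2))).const_mul C
  have hle := le_of_tendsto_of_tendsto (hleft.mono_left nhdsWithin_le_nhds)
    (hright.mono_left nhdsWithin_le_nhds) (by
      filter_upwards [hC, self_mem_nhdsWithin, nhdsWithin_le_nhds hη.map_field,
        nhdsWithin_le_nhds hη.mem_singularSet_iff] with q hCq hq hmap hiff
      exact abs_sub_le_of_abs_crossGram_le (mt hiff.2 hq) hmap (h.compatible q _ _) hCq)
  simpa [-abs_mul, hη.lam_eq_zero hp, hρ] using hle

theorem formII_eq_zero_of_extCurvOn_abs_le (h : IsFrontBundle D φ ψ)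
    (hη : IsNullLift F φ p lam n η) (hp : p ∈ singularSet φ)
    (hd : mvfderiv (𝓡 (k + 1)) lam p ≠ 0) (hρ : inner ℝ (n p) (ψ p (η p)) ≠ 0)
    (hU : U ∈ 𝓝 p) {C : ℝ} (hC : ExtCurvOn φ ψ U (fun c => |c| ≤ C))
    (X Y : TangentSpace (𝓡 (k + 1)) p) : formII φ ψ p X Y = 0 := by
  have hdiag (Z : TangentSpace (𝓡 (k + 1)) p) : inner ℝ (φ p Z) (ψ p Z) = 0 := by
    obtain ⟨Z, hZ, rfl⟩ := exists_smoothFieldAt_eq Z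
    refine h.inner_self_eq_zero_of_abs_crossGram_le (C := C) hη hp hd hρ hZ ?_
    filter_upwards [self_mem_nhdsWithin, nhdsWithin_le_nhds hU] with q hq hqU
    exact hC.abs_crossGram_le ⟨hqU, hq⟩ _ _
  rw [formII, neg_eq_zero]
  exact h.inner_eq_zero_of_forall_self (hdiag X) (hdiag Y) (hdiag _)

theorem eventually_inner_self_eq_zero (h : IsFrontBundle D φ ψ)
    (hη : IsNullLift F φ p lam n η) (hd : mvfderiv (𝓡 (k + 1)) lam p ≠ 0)
    (hρ : inner ℝ (n p) (ψ p (η p)) ≠ 0) (hX : SmoothFieldAt X p) {s : ℝ} (hs : s ≠ 0)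
    (hsign : ∀ᶠ q in 𝓝 p, q ∉ singularSet φ → 0 ≤ s * crossGram (φ q) (ψ q) (X q) (η q)) :
    ∀ᶠ q in 𝓝 p, lam q = 0 → inner ℝ (φ q (X q)) (ψ q (X q)) = 0 := by
  have hn := hη.smoothSectionAt
  have hψX := h.coherent_snd.smoothSectionAt_apply hX
  have hρ_smooth := hn.inner_bundle (h.coherent_snd.smoothSectionAt_apply hη.smoothFieldAt)
  have hG : ContMDiffAt (𝓡 (k + 1)) 𝓘(ℝ, ℝ) ∞ (fun q => s *
      (inner ℝ (φ q (X q)) (ψ q (X q)) * inner ℝ (n q) (ψ q (η q))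
        - lam q * inner ℝ (n q) (ψ q (X q)) ^ 2)) p :=
    contMDiffAt_const.mul (((h.contMDiffAt_inner_apply hX hX).mul hρ_smooth).sub
      (hη.contMDiffAt_lam.mul ((hn.inner_bundle hψX).pow 2)))
  have hzero := eventually_eq_zero_of_mul_nonneg hη.contMDiffAt_lam (by simp) hd
    (eventually_continuousAt_of_contMDiffAt hG) (by
      filter_upwards [hsign, hη.map_field, hη.mem_singularSet_iff] with q hsq hmap hiff hlam
      have hnonneg := hsq (mt hiff.1 hlam)
      rwa [crossGram_of_map_right_eq_smul hmap (h.compatible q _ _), mul_left_comm] at hnonneg)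
  filter_upwards [hzero, hρ_smooth.continuousAt.eventually_ne hρ] with q hq hρq hlam
  simpa [hlam, hs, hρq] using hq hlam

theorem eventually_inner_eq_zero (h : IsFrontBundle D φ ψ)
    (hη : IsNullLift F φ p lam n η) (hd : mvfderiv (𝓡 (k + 1)) lam p ≠ 0)
    (hρ : inner ℝ (n p) (ψ p (η p)) ≠ 0) (hU : U ∈ 𝓝 p)
    (hsign : ExtCurvOn φ ψ U (fun c => 0 ≤ c) ∨ ExtCurvOn φ ψ U (fun c => c ≤ 0))
    (hX : SmoothFieldAt X p) (hY : SmoothFieldAt Y p) :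
    ∀ᶠ q in 𝓝 p, lam q = 0 → inner ℝ (φ q (X q)) (ψ q (Y q)) = 0 := by
  obtain ⟨s, hs, hs_nonneg⟩ : ∃ s : ℝ, s ≠ 0 ∧ ∀ q ∈ U \ singularSet φ, ∀ Z W,
      0 ≤ s * crossGram (φ q) (ψ q) Z W := by
    rcases hsign with hpos | hneg
    · exact ⟨1, by simp, fun q hq Z W => by simpa using hpos.crossGram_nonneg hq Z W⟩
    · exact ⟨-1, by simp, fun q hq Z W => by simpa using hneg.crossGram_nonpos hq Z W⟩
  have hdiag (Z : ∀ x : M, TangentSpace (𝓡 (k + 1)) x) (hZ : SmoothFieldAt Z p) :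
      ∀ᶠ q in 𝓝 p, lam q = 0 → inner ℝ (φ q (Z q)) (ψ q (Z q)) = 0 :=
    h.eventually_inner_self_eq_zero hη hd hρ hZ hs <|
      eventually_of_mem hU fun q hqU hq => hs_nonneg q ⟨hqU, hq⟩ _ _
  filter_upwards [hdiag X hX, hdiag Y hY, hdiag (X + Y) (hX.add_section hY)] with q hXq hYq hXYq hq
  exact h.inner_eq_zero_of_forall_self (hXq hq) (hYq hq) (hXYq hq)

theorem exists_section_inner_ne_zero (h : IsFrontBundle D φ ψ) (hμ : IsCoorientation F μ)
    (he : IsPositiveChart o e) (hpe : p ∈ e.source) (hp : p ∈ singularSet φ)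
    (hd : dJacobian μ φ e p ≠ 0) :
    ∃ n : ∀ x : M, V x, SmoothSectionAt k F n p ∧
      inner ℝ (n p) (ψ p (cofactorField μ φ e n p)) ≠ 0 := by
  obtain ⟨Z, hZ, hφZ⟩ := exists_map_eq_zero_of_mem_singularSet h.coherent_fst.rank_eq hp
  have hψZ : ψ p Z ≠ 0 := fun hzero => hZ (h.front p Z hφZ hzero)
  obtain ⟨n, hn, hnp⟩ := exists_smoothSectionAt_eq (k := k) (F := F) (ψ p Z)
  refine ⟨n, hn, ?_⟩
  have hη := he.isNullLift h.coherent_fst hμ hpe hn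
  have hη_ne : cofactorField μ φ e n p ≠ 0 := by
    refine hη.field_ne_zero h.coherent_fst hp hd fun z hz => hψZ ?_
    have horth : inner ℝ (φ p z) (ψ p Z) = 0 := by rw [h.compatible, hφZ, inner_zero_left]
    rwa [hz, hnp, inner_self_eq_zero] at horth
  obtain ⟨r, rfl⟩ := he.exists_eq_smul_cofactorField hpe hη_ne hφZ
  obtain ⟨hr, -⟩ := smul_ne_zero_iff.1 hZ
  rw [map_smul, smul_ne_zero_iff] at hψZ
  rw [hnp, map_smul, real_inner_smul_left]
  exact mul_ne_zero hr (inner_self_ne_zero.2 hψZ.2)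

end IsFrontBundle

end FrontBundle

section LocalBound

theorem exists_eventually_forall_norm_le_mul {α ι : Type*} [Finite ι] {l : Filter α}
    {f : ι → α → ℝ} {g : α → ℝ} (h : ∀ i, f i =O[l] g) :
    ∃ A ≥ 0, ∀ᶠ x in l, ∀ i, |f i x| ≤ A * |g x| := by
  have := Fintype.ofFinite ι
  have hpi : (fun x i => f i x) =O[l] g := Asymptotics.isBigO_pi.2 h
  obtain ⟨A, hA, hbound⟩ := hpi.exists_nonneg
  refine ⟨A, hA, ?_⟩
  filter_upwards [hbound.bound] with x hx i
  exact (norm_le_pi_norm (fun i => f i x) i).trans hx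

variable {k : ℕ} {M : Type*} [TopologicalSpace M]
  [ChartedSpace (EuclideanSpace ℝ (Fin (k + 1))) M] [IsManifold (𝓡 (k + 1)) ∞ M]
  {F : Type*} [NormedAddCommGroup F] [NormedSpace ℝ F] [FiniteDimensional ℝ F]
  {V : M → Type*} [TopologicalSpace (TotalSpace F V)]
  [∀ x, NormedAddCommGroup (V x)] [∀ x, InnerProductSpace ℝ (V x)]
  [FiberBundle F V] [VectorBundle ℝ F V] [ContMDiffVectorBundle ∞ F V (𝓡 (k + 1))]
  [IsContMDiffRiemannianBundle (𝓡 (k + 1)) ∞ F V]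
  {D : CovariantDerivative (𝓡 (k + 1)) F V}
  {φ ψ : ∀ x : M, TangentSpace (𝓡 (k + 1)) x →L[ℝ] V x} {p : M} {lam : M → ℝ}
  {n : ∀ x : M, V x} {o : ∀ x : M, Orientation ℝ (TangentSpace (𝓡 (k + 1)) x) (Fin (k + 1))}
  {μ : ∀ x : M, V x [⋀^Fin (k + 1)]→ₗ[ℝ] ℝ}
  {e : OpenPartialHomeomorph M (EuclideanSpace ℝ (Fin (k + 1)))} {U : Set M}

theorem IsCoherentTangentBundle.exists_eventually_le_cofactor (h : IsCoherentTangentBundle D φ)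
    (hμ : IsCoorientation F μ) (he : IsPositiveChart o e) (hpe : p ∈ e.source)
    (hn : SmoothSectionAt k F n p) (hne : cofactorField μ φ e n p ≠ 0) :
    ∃ i, ∃ c > 0, ∀ᶠ q in 𝓝 p,
      c ≤ |μ q (Function.update (fun j => φ q (coordVec e j q)) i (n q))| := by
  obtain ⟨i, hi⟩ : ∃ i, μ p (Function.update (fun j => φ p (coordVec e j p)) i (n p)) ≠ 0 := by
    by_contra! hzero
    exact hne (by simp [cofactorField, cofactorVec, hzero])
  have hcont := (hμ.contMDiffAt_update
    (fun j => h.smoothSectionAt_apply (he.smoothFieldAt_coordVec hpe j)) hn i).continuousAt.abs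
  have hpos := abs_pos.2 hi
  exact ⟨i, _, half_pos hpos, hcont.eventually_const_le (half_lt_self hpos)⟩

namespace IsFrontBundle

theorem exists_eventually_abs_crossGram_le (h : IsFrontBundle D φ ψ)
    (hμ : IsCoorientation F μ) (he : IsPositiveChart o e) (hpe : p ∈ e.source)
    (hn : SmoothSectionAt k F n p) (hne : cofactorField μ φ e n p ≠ 0)
    (hII : ∀ j l, (fun q => inner ℝ (φ q (coordVec e j q)) (ψ q (coordVec e l q)))
      =O[𝓝 p] jacobian μ φ e) :
    ∃ C : ℝ, ∀ᶠ q in 𝓝 p, ∀ X Y,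
      |crossGram (φ q) (ψ q) X Y| ≤ C * crossGram (φ q) (φ q) X Y := by
  have hcoord := he.smoothFieldAt_coordVec hpe
  obtain ⟨A, hA, hφψ⟩ := exists_eventually_forall_norm_le_mul fun i : _ × _ => hII i.1 i.2
  obtain ⟨R, hφ⟩ := exists_eventually_norm_le fun j =>
    h.coherent_fst.smoothSectionAt_apply (hcoord j)
  obtain ⟨B, hψ⟩ := exists_eventually_norm_le fun j =>
    h.coherent_snd.smoothSectionAt_apply (hcoord j)
  obtain ⟨i, c, hc, hcof⟩ := h.coherent_fst.exists_eventually_le_cofactor hμ he hpe hn hne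
  apply Exists.intro
  · filter_upwards [hφψ, hφ, hψ, hcof, eventually_norm_le_add_one hn, e.open_source.mem_nhds hpe]
      with q hφψq hφq hψq hcofq hnq hqe X Y
    obtain ⟨b, hb, -⟩ := he.exists_basis hqe
    simp only [jacobian, ← hb] at hφψq hφq hψq hcofq
    exact FrontBundles.abs_crossGram_le (T := (φ q).toLinearMap) (S := (ψ q).toLinearMap)
      ((finrank_fiber q).trans h.coherent_fst.rank_eq)
      (hμ.unit q) (h.compatible q) b hA hc (hnq.trans (le_max_right R _))
      (fun j => (hφq j).trans (le_max_left _ _)) hψq (fun j l => hφψq (j, l)) hcofq X Y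

theorem exists_extCurvOn_abs_le (h : IsFrontBundle D φ ψ) (hμ : IsCoorientation F μ)
    (he : IsPositiveChart o e) (hpe : p ∈ e.source) (hp : p ∈ singularSet φ)
    (hd : dJacobian μ φ e p ≠ 0) (hn : SmoothSectionAt k F n p)
    (hρ : inner ℝ (n p) (ψ p (cofactorField μ φ e n p)) ≠ 0) (hU : U ∈ 𝓝 p)
    (hsign : ExtCurvOn φ ψ U (fun c => 0 ≤ c) ∨ ExtCurvOn φ ψ U (fun c => c ≤ 0)) :
    ∃ W ∈ 𝓝 p, W ⊆ U ∧ ∃ C : ℝ, ExtCurvOn φ ψ W (fun c => |c| ≤ C) := by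
  have hη := he.isNullLift h.coherent_fst hμ hpe hn
  have hcoord := he.smoothFieldAt_coordVec hpe
  have hne : cofactorField μ φ e n p ≠ 0 := fun hzero => hρ (by simp [hzero])
  obtain ⟨C, hC⟩ := h.exists_eventually_abs_crossGram_le hμ he hpe hn hne fun j l =>
    isBigO_of_eventually_eq_zero_of_mvfderiv_ne_zero
      (h.contMDiffAt_inner_apply (hcoord j) (hcoord l)) hη.contMDiffAt_lam (by simp) hd
      (hη.lam_eq_zero hp) (h.eventually_inner_eq_zero hη hd hρ hU hsign (hcoord j) (hcoord l))
  exact ⟨_, inter_mem hU hC, inter_subset_left, C, fun q hq X Y hXY =>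
    abs_extCurv_le_of_abs_crossGram_le hq.2 hXY (hq.1.2 X Y)⟩

end IsFrontBundle

end LocalBound

section SecondOrder

theorem mul_div_sq_le_of_mul_sq_le {δ u a b t w f g l : ℝ} (hl : l ≠ 0)
    (h : δ * (u * a - b * t) ^ 2 ≤ u * w * (f * g)) :
    δ * (u * (a / l) - b / l * t) ^ 2 ≤ u * w * (f / l * (g / l)) := by
  refine le_of_mul_le_mul_right ?_ (sq_pos_of_ne_zero hl)
  calc δ * (u * (a / l) - b / l * t) ^ 2 * l ^ 2 = δ * (u * a - b * t) ^ 2 := by field_simp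
    _ ≤ u * w * (f * g) := h
    _ = u * w * (f / l * (g / l)) * l ^ 2 := by field_simp

variable {k : ℕ} {M : Type*} [TopologicalSpace M]
  [ChartedSpace (EuclideanSpace ℝ (Fin (k + 1))) M] [IsManifold (𝓡 (k + 1)) ∞ M]

/-- A null lift whose section `n` is a unit conormal of the image of `φ`: along the singular set
`n` is orthogonal to the image of `φ`, which at `p` is the whole orthogonal complement of `n`. -/
structure IsConormalNullLift (F : Type*) [NormedAddCommGroup F] [NormedSpace ℝ F]
    {V : M → Type*} [TopologicalSpace (TotalSpace F V)]
    [∀ x, NormedAddCommGroup (V x)] [∀ x, InnerProductSpace ℝ (V x)] [FiberBundle F V]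
    (φ : ∀ x : M, TangentSpace (𝓡 (k + 1)) x →L[ℝ] V x) (p : M)
    (lam : M → ℝ) (n : ∀ x : M, V x) (η : ∀ x : M, TangentSpace (𝓡 (k + 1)) x) : Prop
    extends IsNullLift F φ p lam n η where
  inner_self : inner ℝ (n p) (n p) = 1
  inner_map : ∀ᶠ q in 𝓝 p, q ∈ singularSet φ → ∀ z, inner ℝ (φ q z) (n q) = 0
  exists_map_eq : ∀ u, inner ℝ u (n p) = 0 → ∃ z, φ p z = u

variable {F : Type*} [NormedAddCommGroup F] [NormedSpace ℝ F] [FiniteDimensional ℝ F]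
  {V : M → Type*} [TopologicalSpace (TotalSpace F V)]
  [∀ x, NormedAddCommGroup (V x)] [∀ x, InnerProductSpace ℝ (V x)]
  [FiberBundle F V] [VectorBundle ℝ F V] [ContMDiffVectorBundle ∞ F V (𝓡 (k + 1))]
  [IsContMDiffRiemannianBundle (𝓡 (k + 1)) ∞ F V]
  {D : CovariantDerivative (𝓡 (k + 1)) F V}
  {φ ψ : ∀ x : M, TangentSpace (𝓡 (k + 1)) x →L[ℝ] V x}
  {p : M} {lam : M → ℝ} {n : ∀ x : M, V x} {X η ζ : ∀ x : M, TangentSpace (𝓡 (k + 1)) x}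
  {r δ : ℝ}

theorem IsCoherentTangentBundle.mvfderiv_inner_map (h : IsCoherentTangentBundle D φ)
    (hη : IsNullLift F φ p lam n η) (hp : p ∈ singularSet φ) (hζ : SmoothFieldAt ζ p)
    (hr : ζ p = r • η p) {s : ∀ x : M, V x} (hs : SmoothSectionAt k F s p)
    (hsφ : ∀ z, inner ℝ (φ p z) (s p) = 0) :
    mvfderiv (𝓡 (k + 1)) (fun x => inner ℝ (φ x (ζ x)) (s x)) p (η p) =
      r * mvfderiv (𝓡 (k + 1)) lam p (η p) * inner ℝ (n p) (s p) := by
  obtain ⟨z, hz⟩ := h.exists_connection_swap hζ hη.smoothFieldAt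
  rw [hη.connection_map_field h hp] at hz
  rw [h.mvfderiv_inner (h.smoothSectionAt_apply hζ) hs, hz, inner_add_left, hsφ, hr, map_smul,
    map_smul, hη.map_field_eq_zero hp, smul_zero, inner_zero_left, real_inner_smul_left,
    smul_eq_mul]
  ring

namespace IsFrontBundle

theorem map_eq_smul_of_map_eq_zero (h : IsFrontBundle D φ ψ)
    (hη : IsConormalNullLift F φ p lam n η) (hp : p ∈ singularSet φ)
    {Z : TangentSpace (𝓡 (k + 1)) p} (hZ : φ p Z = 0) :
    ψ p Z = inner ℝ (n p) (ψ p Z) • n p := by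
  rw [← sub_eq_zero]
  set w := ψ p Z - inner ℝ (n p) (ψ p Z) • n p with hw
  have hwn : inner ℝ w (n p) = 0 := by
    rw [hw, inner_sub_left, real_inner_smul_left, hη.inner_self, real_inner_comm, mul_one,
      sub_self]
  obtain ⟨z, hz⟩ := hη.exists_map_eq w hwn
  rw [← inner_self_eq_zero (𝕜 := ℝ)]
  calc inner ℝ w w = inner ℝ (φ p z) (ψ p Z - inner ℝ (n p) (ψ p Z) • n p) := by rw [hz]
    _ = 0 := by
      rw [inner_sub_right, real_inner_smul_right, hη.inner_map.self_of_nhds hp, h.compatible, hZ,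
        inner_zero_left, mul_zero, sub_zero]

theorem inner_map_field_ne_zero (h : IsFrontBundle D φ ψ)
    (hη : IsConormalNullLift F φ p lam n η) (hp : p ∈ singularSet φ) (hne : η p ≠ 0) :
    inner ℝ (n p) (ψ p (η p)) ≠ 0 := fun hzero => by
  have hφη := hη.map_field_eq_zero hp
  have hψη := h.map_eq_smul_of_map_eq_zero hη hp hφη
  rw [hzero, zero_smul] at hψη
  exact hne (h.front p _ hφη hψη)

theorem mvfderiv_inner_self_field (h : IsFrontBundle D φ ψ)
    (hη : IsConormalNullLift F φ p lam n η) (hp : p ∈ singularSet φ)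
    (hd : mvfderiv (𝓡 (k + 1)) lam p ≠ 0) (hII : ∀ X Y, inner ℝ (φ p X) (ψ p Y) = 0)
    (hX : SmoothFieldAt X p) (hXl : mvfderiv (𝓡 (k + 1)) lam p (X p) = 0) :
    mvfderiv (𝓡 (k + 1)) (fun x => inner ℝ (φ x (X x)) (ψ x (X x))) p (η p) =
      inner ℝ (n p) (ψ p (η p)) * inner ℝ (φ p (X p)) (D n p (X p)) := by
  have hφ := h.coherent_fst
  have hφX := hφ.smoothSectionAt_apply hX
  have hψη := h.coherent_snd.smoothSectionAt_apply hη.smoothFieldAt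
  have htangent {f : M → ℝ} (hf : ContMDiffAt (𝓡 (k + 1)) 𝓘(ℝ, ℝ) ∞ f p)
      (hzero : ∀ᶠ q in 𝓝 p, lam q = 0 → f q = 0) : mvfderiv (𝓡 (k + 1)) f p (X p) = 0 :=
    mvfderiv_eq_zero_of_eventually_eq_zero hf hη.contMDiffAt_lam (by simp) hd
      (hη.lam_eq_zero hp) hzero hXl
  have hdII : mvfderiv (𝓡 (k + 1)) (fun x => inner ℝ (φ x (X x)) (ψ x (η x))) p (X p) = 0 := by
    refine htangent (hφX.inner_bundle hψη) ?_
    filter_upwards [hη.map_field] with q hmap hq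
    rw [h.compatible, hmap, hq, zero_smul, inner_zero_left]
  have hdn : mvfderiv (𝓡 (k + 1)) (fun x => inner ℝ (φ x (X x)) (n x)) p (X p) = 0 := by
    refine htangent (hφX.inner_bundle hη.smoothSectionAt) ?_
    filter_upwards [hη.inner_map, hη.mem_singularSet_iff] with q hq hiff hlam
    exact hq (hiff.2 hlam) _
  rw [hφ.mvfderiv_inner hφX hψη, h.map_eq_smul_of_map_eq_zero hη hp (hη.map_field_eq_zero hp),
    real_inner_smul_right] at hdII
  rw [hφ.mvfderiv_inner hφX hη.smoothSectionAt] at hdn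
  obtain ⟨z, hz⟩ := hφ.exists_connection_swap hX hη.smoothFieldAt
  obtain ⟨w, hw⟩ := h.coherent_snd.exists_connection_swap hX hη.smoothFieldAt
  rw [hη.connection_map_field hφ hp, hXl, zero_smul, zero_add] at hz
  rw [hφ.mvfderiv_inner hφX (h.coherent_snd.smoothSectionAt_apply hX), hz, hw, hII, zero_add,
    inner_add_right, hII, add_zero]
  linear_combination hdII - inner ℝ (n p) (ψ p (η p)) * hdn

theorem mvfderiv_inner_self_null (h : IsFrontBundle D φ ψ) (hη : IsNullLift F φ p lam n η)
    (hp : p ∈ singularSet φ) (hζ : SmoothFieldAt ζ p) (hr : ζ p = r • η p) :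
    mvfderiv (𝓡 (k + 1)) (fun x => inner ℝ (φ x (ζ x)) (ψ x (ζ x))) p (η p) =
      r ^ 2 * (mvfderiv (𝓡 (k + 1)) lam p (η p) * inner ℝ (n p) (ψ p (η p))) := by
  rw [h.coherent_fst.mvfderiv_inner_map hη hp hζ hr (h.coherent_snd.smoothSectionAt_apply hζ)
    fun z => by rw [h.compatible, hr, map_smul, hη.map_field_eq_zero hp, smul_zero,
      inner_zero_left], hr, map_smul, real_inner_smul_right]
  ring

theorem inner_eq_zero_of_crossGram_nonneg (h : IsFrontBundle D φ ψ)
    (hη : IsNullLift F φ p lam n η) (hp : p ∈ singularSet φ)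
    (hdη : mvfderiv (𝓡 (k + 1)) lam p (η p) ≠ 0) (hρ : inner ℝ (n p) (ψ p (η p)) ≠ 0)
    (hζ : SmoothFieldAt ζ p) (hr₀ : r ≠ 0) (hr : ζ p = r • η p)
    (hnull : ∀ᶠ q in 𝓝 p, q ∈ singularSet φ → φ q (ζ q) = 0)
    (hK : ∀ᶠ q in 𝓝 p, q ∉ singularSet φ → ∀ X, 0 ≤ crossGram (φ q) (ψ q) X (ζ q))
    (X Y : TangentSpace (𝓡 (k + 1)) p) : inner ℝ (φ p X) (ψ p Y) = 0 := by
  have hd : mvfderiv (𝓡 (k + 1)) (fun x => inner ℝ (φ x (ζ x)) (ψ x (ζ x))) p ≠ 0 := fun hzero =>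
    mul_ne_zero (pow_ne_zero 2 hr₀) (mul_ne_zero hdη hρ) <| by
      rw [← h.mvfderiv_inner_self_null hη hp hζ hr, hzero, zero_apply]
  have hdiag (Z : TangentSpace (𝓡 (k + 1)) p) : inner ℝ (φ p Z) (ψ p Z) = 0 := by
    obtain ⟨Z, hZ, rfl⟩ := exists_smoothFieldAt_eq Z
    refine (eventually_eq_zero_of_mul_nonneg (h.contMDiffAt_inner_apply hζ hζ) (by simp) hd
      (eventually_continuousAt_of_contMDiffAt (h.contMDiffAt_inner_apply hZ hZ))
      ?_).self_of_nhds (by rw [hnull.self_of_nhds hp, inner_zero_left])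
    filter_upwards [hnull, hK] with q hnullq hKq hne
    have hq : q ∉ singularSet φ := fun hq => hne (by rw [hnullq hq, inner_zero_left])
    rw [mul_comm]
    exact (sq_nonneg _).trans (sub_nonneg.1 (hKq hq (Z q)))
  exact h.inner_eq_zero_of_forall_self (hdiag X) (hdiag Y) (hdiag _)

theorem mul_sq_mvfderiv_div_le (h : IsFrontBundle D φ ψ)
    (hη : IsConormalNullLift F φ p lam n η) (hp : p ∈ singularSet φ)
    {v : TangentSpace (𝓡 (k + 1)) p} (hv : mvfderiv (𝓡 (k + 1)) lam p v ≠ 0)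
    (hζ : SmoothFieldAt ζ p) (hζp : φ p (ζ p) = 0) (hδ : 0 ≤ δ)
    (hK : ∀ᶠ q in 𝓝 p, q ∉ singularSet φ → ∀ X,
      δ * crossGram (φ q) (φ q) X (ζ q) ≤ crossGram (φ q) (ψ q) X (ζ q))
    (hX : SmoothFieldAt X p) (hXp : inner ℝ (φ p (X p)) (ψ p (X p)) = 0) :
    δ * (inner ℝ (φ p (X p)) (φ p (X p)) *
        (mvfderiv (𝓡 (k + 1)) (fun x => inner ℝ (φ x (ζ x)) (n x)) p v /
          mvfderiv (𝓡 (k + 1)) lam p v)) ^ 2 ≤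
      inner ℝ (φ p (X p)) (φ p (X p)) *
        (mvfderiv (𝓡 (k + 1)) (fun x => inner ℝ (φ x (X x)) (ψ x (X x))) p v /
            mvfderiv (𝓡 (k + 1)) lam p v *
          (mvfderiv (𝓡 (k + 1)) (fun x => inner ℝ (φ x (ζ x)) (ψ x (ζ x))) p v /
            mvfderiv (𝓡 (k + 1)) lam p v)) := by
  have hn := hη.smoothSectionAt
  have hφX := h.coherent_fst.smoothSectionAt_apply hX
  have hφζ := h.coherent_fst.smoothSectionAt_apply hζ
  obtain ⟨l, hl, hlp, hlam, hlim⟩ := exists_filter_tendsto_div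
    (hη.contMDiffAt_lam.mdifferentiableAt (by simp)) (hη.lam_eq_zero hp) hv
  have hquot {f : M → ℝ} (hf : ContMDiffAt (𝓡 (k + 1)) 𝓘(ℝ, ℝ) ∞ f p) (hfp : f p = 0) :=
    hlim f (hf.mdifferentiableAt (by simp)) hfp
  have hcont {s t : ∀ x : M, V x} (hs : SmoothSectionAt k F s p) (ht : SmoothSectionAt k F t p) :
      Tendsto (fun x => inner ℝ (s x) (t x)) l (𝓝 (inner ℝ (s p) (t p))) :=
    (ContMDiffAt.inner_bundle hs ht).continuousAt.tendsto.mono_left hlp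
  have hleft := (((hcont hφX hφX).mul (hquot (hφζ.inner_bundle hn) (by simp [hζp]))).sub
    ((hquot (hφζ.inner_bundle hφX) (by simp [hζp])).mul (hcont hφX hn))).pow 2 |>.const_mul δ
  have hright := ((hcont hφX hφX).mul (hcont hn hn)).mul
    ((hquot (h.contMDiffAt_inner_apply hX hX) hXp).mul
      (hquot (h.contMDiffAt_inner_apply hζ hζ) (by simp [hζp])))
  have hle := le_of_tendsto_of_tendsto hleft hright (by
    filter_upwards [hlam, hlp hK, hlp hη.mem_singularSet_iff] with q hq hKq hiff
    exact mul_div_sq_le_of_mul_sq_le hq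
      (mul_sq_inner_le_of_mul_crossGram_self_le hδ (hKq (mt hiff.1 hq) (X q)) (n q)))
  rwa [hη.inner_map.self_of_nhds hp, mul_zero, sub_zero, hη.inner_self, mul_one] at hle

theorem mul_inner_self_le (h : IsFrontBundle D φ ψ)
    (hη : IsConormalNullLift F φ p lam n η) (hp : p ∈ singularSet φ)
    (hdη : mvfderiv (𝓡 (k + 1)) lam p (η p) ≠ 0)
    (hζ : SmoothFieldAt ζ p) (hr₀ : r ≠ 0) (hr : ζ p = r • η p) (hδ : 0 ≤ δ)
    (hnull : ∀ᶠ q in 𝓝 p, q ∈ singularSet φ → φ q (ζ q) = 0)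
    (hK : ∀ᶠ q in 𝓝 p, q ∉ singularSet φ → ∀ X,
      δ * crossGram (φ q) (φ q) X (ζ q) ≤ crossGram (φ q) (ψ q) X (ζ q))
    {X : TangentSpace (𝓡 (k + 1)) p} (hφX : φ p X ≠ 0)
    (hXl : mvfderiv (𝓡 (k + 1)) lam p X = 0) :
    δ * inner ℝ (φ p X) (φ p X) ≤ inner ℝ (n p) (ψ p (η p)) ^ 2 /
      mvfderiv (𝓡 (k + 1)) lam p (η p) * inner ℝ (φ p X) (D n p X) := by
  have hρ := h.inner_map_field_ne_zero hη hp fun hzero => hdη (by rw [hzero, map_zero])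
  have hII := h.inner_eq_zero_of_crossGram_nonneg hη.toIsNullLift hp hdη hρ hζ hr₀ hr hnull (by
    filter_upwards [hK] with q hKq hq X
    exact (mul_nonneg hδ (crossGram_self_nonneg _ X (ζ q))).trans (hKq hq X))
  obtain ⟨X, hX, rfl⟩ := exists_smoothFieldAt_eq X
  have hle := h.mul_sq_mvfderiv_div_le hη hp hdη hζ (hnull.self_of_nhds hp) hδ hK hX (hII _ _)
  rw [h.coherent_fst.mvfderiv_inner_map hη.toIsNullLift hp hζ hr hη.smoothSectionAt
      (hη.inner_map.self_of_nhds hp), hη.inner_self,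
    h.mvfderiv_inner_self_null hη.toIsNullLift hp hζ hr,
    h.mvfderiv_inner_self_field hη hp (fun hzero => hdη (by simp [hzero])) hII hX hXl] at hle
  have hpos : 0 < inner ℝ (φ p (X p)) (φ p (X p)) * r ^ 2 :=
    mul_pos (real_inner_self_pos.2 hφX) (sq_pos_of_ne_zero hr₀)
  refine le_of_mul_le_mul_left ((le_of_eq ?_).trans (hle.trans_eq ?_)) hpos <;> field_simp

end IsFrontBundle

end SecondOrder

section AdaptedFrame

variable {k : ℕ} {M : Type*} [TopologicalSpace M]
  [ChartedSpace (EuclideanSpace ℝ (Fin (k + 1))) M] [IsManifold (𝓡 (k + 1)) ∞ M]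
  {F : Type*} [NormedAddCommGroup F] [NormedSpace ℝ F]
  {V : M → Type*} [TopologicalSpace (TotalSpace F V)]
  [∀ x, NormedAddCommGroup (V x)] [∀ x, InnerProductSpace ℝ (V x)] [FiberBundle F V]
  {o : ∀ x : M, Orientation ℝ (TangentSpace (𝓡 (k + 1)) x) (Fin (k + 1))}
  {μ : ∀ x : M, V x [⋀^Fin (k + 1)]→ₗ[ℝ] ℝ}
  {φ : ∀ x : M, TangentSpace (𝓡 (k + 1)) x →L[ℝ] V x} {p q : M}

namespace AdaptedFrame

theorem inner_conormal_self (A : AdaptedFrame F o μ φ p) (hq : q ∈ A.dom) :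
    inner ℝ (A.conormal q) (A.conormal q) = 1 := by
  have hnorm := (A.frame_orthonormal q hq).1 (Fin.last k)
  rw [Fin.snoc_last] at hnorm
  rw [real_inner_self_eq_norm_sq, hnorm, one_pow]

theorem smoothSectionAt_conormal (A : AdaptedFrame F o μ φ p) :
    SmoothSectionAt k F A.conormal p :=
  A.conormal_smooth.contMDiffAt (A.dom_open.mem_nhds A.mem_dom)

theorem mem_chart_source (A : AdaptedFrame F o μ φ p) : p ∈ A.chart.source :=
  A.dom_subset A.mem_dom

theorem exists_basis (A : AdaptedFrame F o μ φ p) :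
    ∃ B : Module.Basis (Fin (k + 1)) ℝ (TangentSpace (𝓡 (k + 1)) p),
      (∀ i : Fin k, B i.castSucc = A.vec i p) ∧ B (Fin.last k) = A.null ∧
        B.orientation = o p := by
  obtain ⟨B, hB, hBo⟩ := A.null_pos
  exact ⟨B, fun i => by rw [hB, Fin.snoc_castSucc], by rw [hB, Fin.snoc_last], hBo⟩

theorem null_ne_zero (A : AdaptedFrame F o μ φ p) : A.null ≠ 0 := by
  obtain ⟨B, -, hlast, -⟩ := A.exists_basis
  exact hlast ▸ B.ne_zero _

theorem exists_cofactorField_eq (A : AdaptedFrame F o μ φ p)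
    {e : OpenPartialHomeomorph M (EuclideanSpace ℝ (Fin (k + 1)))} (he : IsPositiveChart o e)
    (hpe : p ∈ e.source) :
    ∃ r : ℝ, 0 < r ∧ cofactorField μ φ e A.conormal p = r • A.null := by
  obtain ⟨b, hb, hbo⟩ := he.exists_basis hpe
  obtain ⟨B, hcast, hlast, hBo⟩ := A.exists_basis
  have hdet : 0 < b.det B := (Module.Basis.orientation_eq_iff_det_pos b B).1 (hbo.trans hBo.symm)
  refine ⟨(b.det B)⁻¹, inv_pos.2 hdet, ?_⟩
  have hcof := cofactorVec_eq_inv_det_smul (μ p) (φ p).toLinearMap b B (n := A.conormal p)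
    (by rw [hlast]; exact A.null_mem) (by simp only [hcast]; exact A.frame_pos p A.mem_dom)
  rw [← hlast, ← hcof]
  simp only [cofactorField, cofactorVec, hb]

theorem exists_eq_smul_null (A : AdaptedFrame F o μ φ p) {Z : TangentSpace (𝓡 (k + 1)) p}
    (hZ : φ p Z = 0) : ∃ r : ℝ, Z = r • A.null := by
  obtain ⟨r, hr, hη⟩ := A.exists_cofactorField_eq A.chart_pos A.mem_chart_source
  obtain ⟨t, ht⟩ := A.chart_pos.exists_eq_smul_cofactorField A.mem_chart_source
    (by rw [hη]; exact smul_ne_zero hr.ne' A.null_ne_zero) hZ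
  exact ⟨t * r, by rw [ht, hη, smul_smul]⟩

theorem map_ne_zero_of_mem_singularTangent (A : AdaptedFrame F o μ φ p)
    (hnull : dJacobian μ φ A.chart p A.null ≠ 0) {X : singularTangent μ φ A.chart p}
    (hX : X ≠ 0) : φ p X ≠ 0 := fun hφX => by
  obtain ⟨r, hr⟩ := A.exists_eq_smul_null hφX
  have hd : dJacobian μ φ A.chart p X = 0 := X.2
  rw [hr, map_smul, smul_eq_mul] at hd
  rw [(mul_eq_zero.1 hd).resolve_right hnull, zero_smul] at hr
  exact hX (Subtype.ext hr)

theorem exists_mem_singularTangent_map_eq (A : AdaptedFrame F o μ φ p)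
    (hnull : dJacobian μ φ A.chart p A.null ≠ 0) (z : TangentSpace (𝓡 (k + 1)) p) :
    ∃ w ∈ singularTangent μ φ A.chart p, φ p w = φ p z := by
  refine ⟨z - (dJacobian μ φ A.chart p z / dJacobian μ φ A.chart p A.null) • A.null, ?_, ?_⟩
  · change dJacobian μ φ A.chart p _ = 0
    rw [map_sub, map_smul, smul_eq_mul, div_mul_cancel₀ _ hnull, sub_self]
  · rw [map_sub, map_smul, A.null_mem, smul_zero, sub_zero]

section Conormal

variable [VectorBundle ℝ F V]

theorem exists_eq_map_add_smul (A : AdaptedFrame F o μ φ p) (h : Module.finrank ℝ F = k + 1)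
    (hq : q ∈ A.dom) (u : V q) :
    ∃ z, u = φ q z + inner ℝ u (A.conormal q) • A.conormal q := by
  have hV := (finrank_fiber (V := V) q).trans h
  have : FiniteDimensional ℝ (V q) := .of_finrank_eq_succ hV
  have hon := A.frame_orthonormal q hq
  let b := OrthonormalBasis.mk hon
    (hon.linearIndependent.span_eq_top_of_card_eq_finrank (by simp [hV])).ge
  refine ⟨∑ i, inner ℝ (φ q (A.vec i q)) u • A.vec i q, ?_⟩
  have hsum := b.sum_repr' u
  simp only [b, OrthonormalBasis.coe_mk, Fin.sum_univ_castSucc, Fin.snoc_castSucc,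
    Fin.snoc_last] at hsum
  rw [map_sum, real_inner_comm]
  simp only [map_smul]
  exact hsum.symm

theorem inner_map_conormal (A : AdaptedFrame F o μ φ p) (h : Module.finrank ℝ F = k + 1)
    (hq : q ∈ A.dom) (hs : q ∈ singularSet φ) (z : TangentSpace (𝓡 (k + 1)) q) :
    inner ℝ (φ q z) (A.conormal q) = 0 := by
  by_contra hne
  obtain ⟨y, hy⟩ := A.exists_eq_map_add_smul h hq (φ q z)
  rw [← sub_eq_iff_eq_add', ← map_sub] at hy
  have hsurj : Function.Surjective (φ q) := fun u => by
    obtain ⟨x, hx⟩ := A.exists_eq_map_add_smul h hq u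
    refine ⟨x + inner ℝ u (A.conormal q) • (inner ℝ (φ q z) (A.conormal q))⁻¹ • (z - y), ?_⟩
    rw [map_add, map_smul, map_smul, hy, inv_smul_smul₀ hne, ← hx]
  exact hs ⟨(injective_iff_surjective_of_finrank_eq h _).2 hsurj, hsurj⟩

theorem map_ne_conormal (A : AdaptedFrame F o μ φ p) (h : Module.finrank ℝ F = k + 1)
    (hp : p ∈ singularSet φ) (z : TangentSpace (𝓡 (k + 1)) p) : φ p z ≠ A.conormal p := by
  intro hz
  have hzero := A.inner_map_conormal h A.mem_dom hp z
  rw [hz, A.inner_conormal_self A.mem_dom] at hzero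
  exact one_ne_zero hzero

end Conormal

variable [FiniteDimensional ℝ F] [VectorBundle ℝ F V]
  [ContMDiffVectorBundle ∞ F V (𝓡 (k + 1))] [IsContMDiffRiemannianBundle (𝓡 (k + 1)) ∞ F V]
  {D : CovariantDerivative (𝓡 (k + 1)) F V}

theorem isConormalNullLift (A : AdaptedFrame F o μ φ p) (h : IsCoherentTangentBundle D φ)
    (hμ : IsCoorientation F μ) :
    IsConormalNullLift F φ p (jacobian μ φ A.chart) A.conormal
      (cofactorField μ φ A.chart A.conormal) where
  toIsNullLift := A.chart_pos.isNullLift h hμ A.mem_chart_source A.smoothSectionAt_conormal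
  inner_self := A.inner_conormal_self A.mem_dom
  inner_map := by
    filter_upwards [A.dom_open.mem_nhds A.mem_dom] with q hq hqs
    exact A.inner_map_conormal h.rank_eq hq hqs
  exists_map_eq u hu := by
    obtain ⟨z, hz⟩ := A.exists_eq_map_add_smul h.rank_eq A.mem_dom u
    exact ⟨z, by rw [hz, hu, zero_smul, add_zero]⟩

theorem dJacobian_null_ne_zero (A : AdaptedFrame F o μ φ p) (h : IsCoherentTangentBundle D φ)
    (hμ : IsCoorientation F μ) (hp : IsA2Point o μ φ p) :
    dJacobian μ φ A.chart p A.null ≠ 0 := by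
  obtain ⟨hps, e, hpe, he, hd, hsup⟩ := hp
  have hnull : dJacobian μ φ e p A.null ≠ 0 := by
    intro hzero
    apply hd
    ext w
    obtain ⟨y, hy, z, hz, rfl⟩ := Submodule.mem_sup.1 (hsup ▸ Submodule.mem_top (x := w))
    obtain ⟨r, rfl⟩ := A.exists_eq_smul_null hy
    have hz : dJacobian μ φ e p z = 0 := hz
    simp [hzero, hz]
  obtain ⟨r, -, hη⟩ := A.exists_cofactorField_eq he hpe
  obtain ⟨s, hs, hη'⟩ := A.exists_cofactorField_eq A.chart_pos A.mem_chart_source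
  have hcomm := (he.isNullLift h hμ hpe A.smoothSectionAt_conormal).mvfderiv_field_comm
    (A.isConormalNullLift h hμ).toIsNullLift h hps (A.map_ne_conormal h.rank_eq hps)
  rw [hη, hη', map_smul, map_smul] at hcomm
  change s • dJacobian μ φ e p A.null = r • dJacobian μ φ A.chart p A.null at hcomm
  intro hzero
  rw [hzero, smul_zero] at hcomm
  exact smul_ne_zero hs.ne' hnull hcomm

theorem inner_connection_conormal (A : AdaptedFrame F o μ φ p)
    (h : IsCoherentTangentBundle D φ) (X : TangentSpace (𝓡 (k + 1)) p) :
    inner ℝ (D A.conormal p X) (A.conormal p) = 0 := by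
  have hn := A.smoothSectionAt_conormal
  have hconst : (fun x => inner ℝ (A.conormal x) (A.conormal x)) =ᶠ[𝓝 p] fun _ => (1 : ℝ) := by
    filter_upwards [A.dom_open.mem_nhds A.mem_dom] with q hq
    exact A.inner_conormal_self hq
  have hzero : mvfderiv (𝓡 (k + 1)) (fun x => inner ℝ (A.conormal x) (A.conormal x)) p X = 0 := by
    rw [mvfderiv, hconst.mfderiv_eq, mfderiv_const]
    rfl
  rw [h.mvfderiv_inner hn hn, real_inner_comm (D A.conormal p X)] at hzero
  exact self_eq_neg.1 (eq_neg_of_add_eq_zero_left hzero)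

theorem map_shapeOperator (A : AdaptedFrame F o μ φ p) (h : IsCoherentTangentBundle D φ)
    (hμ : IsCoorientation F μ) (hnull : dJacobian μ φ A.chart p A.null ≠ 0)
    (X : singularTangent μ φ A.chart p) :
    φ p (A.shapeOperator D X) =
      -Real.sign (dJacobian μ φ A.chart p A.null) • D A.conormal p X := by
  set T := (φ p).toLinearMap.domRestrict (singularTangent μ φ A.chart p)
  have hT : T.ker = ⊥ := LinearMap.ker_eq_bot'.2 fun Z hZ => by_contra fun hne =>
    A.map_ne_zero_of_mem_singularTangent hnull hne hZ
  obtain ⟨z, hz⟩ := (A.isConormalNullLift h hμ).exists_map_eq _ (A.inner_connection_conormal h X)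
  obtain ⟨w, hw, hwz⟩ := A.exists_mem_singularTangent_map_eq hnull z
  have hTw : T ⟨w, hw⟩ = D A.conormal p X := hwz.trans hz
  have hS : A.shapeOperator D X =
      -Real.sign (dJacobian μ φ A.chart p A.null) • (⟨w, hw⟩ : singularTangent μ φ A.chart p) := by
    rw [← LinearMap.leftInverse_apply_of_inj hT ⟨w, hw⟩, hTw]
    rfl
  rw [hS, Submodule.coe_smul, map_smul, ← hTw]
  rfl

theorem exists_eigenvector (A : AdaptedFrame F o μ φ p) (h : IsCoherentTangentBundle D φ)
    (hμ : IsCoorientation F μ) (hnull : dJacobian μ φ A.chart p A.null ≠ 0) {c : ℝ}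
    (hc : Module.End.HasEigenvalue (A.shapeOperator D) c) :
    ∃ X, φ p X ≠ 0 ∧ dJacobian μ φ A.chart p X = 0 ∧
      c • φ p X = -Real.sign (dJacobian μ φ A.chart p A.null) • D A.conormal p X := by
  obtain ⟨X, hX⟩ := hc.exists_hasEigenvector
  refine ⟨X, A.map_ne_zero_of_mem_singularTangent hnull hX.2, X.2, ?_⟩
  rw [← A.map_shapeOperator h hμ hnull, hX.apply_eq_smul, Submodule.coe_smul, map_smul]

end AdaptedFrame

end AdaptedFrame

section SingularPrincipalCurvature

variable {k : ℕ} {M : Type*} [TopologicalSpace M]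
  [ChartedSpace (EuclideanSpace ℝ (Fin (k + 1))) M] [IsManifold (𝓡 (k + 1)) ∞ M]
  {F : Type*} [NormedAddCommGroup F] [NormedSpace ℝ F] [FiniteDimensional ℝ F]
  {V : M → Type*} [TopologicalSpace (TotalSpace F V)]
  [∀ x, NormedAddCommGroup (V x)] [∀ x, InnerProductSpace ℝ (V x)]
  [FiberBundle F V] [VectorBundle ℝ F V] [ContMDiffVectorBundle ∞ F V (𝓡 (k + 1))]
  [IsContMDiffRiemannianBundle (𝓡 (k + 1)) ∞ F V]
  {o : ∀ x : M, Orientation ℝ (TangentSpace (𝓡 (k + 1)) x) (Fin (k + 1))}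
  {μ : ∀ x : M, V x [⋀^Fin (k + 1)]→ₗ[ℝ] ℝ}
  {D : CovariantDerivative (𝓡 (k + 1)) F V}
  {φ ψ : ∀ x : M, TangentSpace (𝓡 (k + 1)) x →L[ℝ] V x}
  {p : M} {U : Set M} {ζ : ∀ x : M, TangentSpace (𝓡 (k + 1)) x} {c δ : ℝ}

namespace IsFrontBundle

theorem exists_le_neg_mul_of_isSingularPrincipalCurvature (h : IsFrontBundle D φ ψ)
    (hμ : IsCoorientation F μ) (hp : IsA2Point o μ φ p)
    (hc : IsSingularPrincipalCurvature D o μ φ p c) (hζ : SmoothFieldAt ζ p) (hζ₀ : ζ p ≠ 0)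
    (hnull : ∀ᶠ q in 𝓝 p, q ∈ singularSet φ → φ q (ζ q) = 0) (hδ : 0 ≤ δ)
    (hK : ∀ᶠ q in 𝓝 p, q ∉ singularSet φ → ∀ X,
      δ * crossGram (φ q) (φ q) X (ζ q) ≤ crossGram (φ q) (ψ q) X (ζ q)) :
    ∃ a : ℝ, 0 < a ∧ δ ≤ -(a * c) := by
  obtain ⟨A, hA⟩ := hc
  have hη := A.isConormalNullLift h.coherent_fst hμ
  have hd := A.dJacobian_null_ne_zero h.coherent_fst hμ hp
  obtain ⟨r, hr, hηA⟩ := A.exists_cofactorField_eq A.chart_pos A.mem_chart_source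
  obtain ⟨t, ht⟩ := A.exists_eq_smul_null (hnull.self_of_nhds hp.1)
  obtain ⟨X, hφX, hXl, hXc⟩ := A.exists_eigenvector h.coherent_fst hμ hd hA
  set d := dJacobian μ φ A.chart p A.null with hd_def
  set η := cofactorField μ φ A.chart A.conormal
  have ht₀ : t ≠ 0 := fun hzero => hζ₀ (by rw [ht, hzero, zero_smul])
  have hζη : ζ p = (t / r) • η p := by rw [hηA, smul_smul, div_mul_cancel₀ _ hr.ne', ht]
  have hdη : mvfderiv (𝓡 (k + 1)) (jacobian μ φ A.chart) p (η p) = r * d := by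
    rw [hηA, map_smul, smul_eq_mul, hd_def, dJacobian]
  have hdη₀ := hdη.trans_ne (mul_ne_zero hr.ne' hd)
  have hρ := h.inner_map_field_ne_zero hη hp.1 fun hzero => hdη₀ (by rw [hzero, map_zero])
  have hle := h.mul_inner_self_le hη hp.1 hdη₀ hζ (div_ne_zero ht₀ hr.ne') hζη hδ hnull hK hφX hXl
  have heig := congrArg (fun u => inner ℝ (φ p X) u) hXc
  simp only [real_inner_smul_right] at heig
  have hs : 0 < d.sign * d := Real.sign_mul_pos_of_ne_zero d hd
  have hs₀ : d.sign ≠ 0 := left_ne_zero_of_mul hs.ne'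
  refine ⟨inner ℝ (A.conormal p) (ψ p (η p)) ^ 2 / (r * (d.sign * d)), by positivity,
    le_of_mul_le_mul_right (hle.trans_eq ?_) (real_inner_self_pos.2 hφX)⟩
  rw [neg_mul, mul_assoc, heig, hdη]
  field_simp

theorem isSingularPrincipalCurvature_nonpos (h : IsFrontBundle D φ ψ)
    (hμ : IsCoorientation F μ) (hp : IsA2Point o μ φ p) (hU : U ∈ 𝓝 p)
    (hK : ExtCurvOn φ ψ U (fun c => 0 ≤ c)) (hc : IsSingularPrincipalCurvature D o μ φ p c) :
    c ≤ 0 := by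
  obtain ⟨A, -⟩ := id hc
  have hη := A.isConormalNullLift h.coherent_fst hμ
  obtain ⟨r, hr, hηA⟩ := A.exists_cofactorField_eq A.chart_pos A.mem_chart_source
  have hnull : ∀ᶠ q in 𝓝 p, q ∈ singularSet φ →
      φ q (cofactorField μ φ A.chart A.conormal q) = 0 := by
    filter_upwards [hη.mem_singularSet_iff, hη.map_field] with q hiff hmap hq
    rw [hmap, hiff.1 hq, zero_smul]
  obtain ⟨a, ha, hac⟩ := h.exists_le_neg_mul_of_isSingularPrincipalCurvature hμ hp hc
    hη.smoothFieldAt (by rw [hηA]; exact smul_ne_zero hr.ne' A.null_ne_zero) hnull le_rfl (by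
      filter_upwards [hU] with q hqU hq X
      rw [zero_mul]
      exact hK.crossGram_nonneg ⟨hqU, hq⟩ X _)
  exact nonpos_of_mul_nonpos_right (neg_nonneg.1 hac) ha

theorem isSingularPrincipalCurvature_neg (h : IsFrontBundle D φ ψ)
    (hμ : IsCoorientation F μ) (hp : IsA2Point o μ φ p) (hU : U ∈ 𝓝 p) (hζ : SmoothFieldAt ζ p)
    (hδ : 0 < δ) (hnull : ∀ q ∈ U ∩ singularSet φ, ζ q ≠ 0 ∧ φ q (ζ q) = 0)
    (hK : ∀ q ∈ U \ singularSet φ, ∀ X : TangentSpace (𝓡 (k + 1)) q,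
      LinearIndependent ℝ ![X, ζ q] → δ ≤ extCurv φ ψ q X (ζ q))
    (hc : IsSingularPrincipalCurvature D o μ φ p c) : c < 0 := by
  obtain ⟨a, ha, hac⟩ := h.exists_le_neg_mul_of_isSingularPrincipalCurvature hμ hp hc hζ
    (hnull p ⟨mem_of_mem_nhds hU, hp.1⟩).1
    (by filter_upwards [hU] with q hqU hq using (hnull q ⟨hqU, hq⟩).2) hδ.le (by
      filter_upwards [hU] with q hqU hq X
      exact mul_crossGram_self_le_of_le_extCurv hq (hK q ⟨hqU, hq⟩ X))
  exact neg_of_mul_neg_right (neg_pos.1 (hδ.trans_le hac)) ha.le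

end IsFrontBundle

end SingularPrincipalCurvature

end FrontBundles

open FrontBundles in
theorem theorem3 {k : ℕ} {M : Type*} [TopologicalSpace M] [T2Space M]
    [ChartedSpace (EuclideanSpace ℝ (Fin (k + 1))) M]
    [IsManifold (𝓡 (k + 1)) ∞ M]
    {F : Type*} [NormedAddCommGroup F] [NormedSpace ℝ F] [FiniteDimensional ℝ F]
    {V : M → Type*} [TopologicalSpace (TotalSpace F V)]
    [∀ x, NormedAddCommGroup (V x)] [∀ x, InnerProductSpace ℝ (V x)]
    [FiberBundle F V] [VectorBundle ℝ F V]
    [ContMDiffVectorBundle ∞ F V (𝓡 (k + 1))]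
    [IsContMDiffRiemannianBundle (𝓡 (k + 1)) ∞ F V]
    (o : ∀ x : M, Orientation ℝ (TangentSpace (𝓡 (k + 1)) x) (Fin (k + 1)))
    (ho : IsManifoldOrientation o)
    (μ : ∀ x : M, V x [⋀^Fin (k + 1)]→ₗ[ℝ] ℝ) (hμ : IsCoorientation F μ)
    (D : CovariantDerivative (𝓡 (k + 1)) F V)
    (φ ψ : ∀ x : M, TangentSpace (𝓡 (k + 1)) x →L[ℝ] V x)
    (hfront : IsFrontBundle D φ ψ)
    (p : M) (hp : IsA2Point o μ φ p) :
    ((∃ U ∈ 𝓝 p, ∃ C : ℝ, ExtCurvOn φ ψ U (fun c => |c| ≤ C)) →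
      ∀ X Y : TangentSpace (𝓡 (k + 1)) p, formII φ ψ p X Y = 0) ∧
    (∀ U ∈ 𝓝 p, ExtCurvOn φ ψ U (fun c => 0 ≤ c) ∨ ExtCurvOn φ ψ U (fun c => c ≤ 0) →
      ∃ W ∈ 𝓝 p, W ⊆ U ∧ ∃ C : ℝ, ExtCurvOn φ ψ W (fun c => |c| ≤ C)) ∧
    ((∃ U ∈ 𝓝 p, ExtCurvOn φ ψ U (fun c => 0 ≤ c)) →
      ∀ c : ℝ, IsSingularPrincipalCurvature D o μ φ p c → c ≤ 0) ∧
    ((∃ (U : Set M) (η : ∀ x : M, TangentSpace (𝓡 (k + 1)) x) (δ : ℝ),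
        IsOpen U ∧ p ∈ U ∧ 0 < δ ∧
        ContMDiffOn (𝓡 (k + 1)) ((𝓡 (k + 1)).prod 𝓘(ℝ, EuclideanSpace ℝ (Fin (k + 1)))) ∞
          (fun x => TotalSpace.mk' (EuclideanSpace ℝ (Fin (k + 1))) x (η x)) U ∧
        (∀ q ∈ U ∩ singularSet φ, η q ≠ 0 ∧ φ q (η q) = 0) ∧
        (∀ q ∈ U \ singularSet φ, ∀ X : TangentSpace (𝓡 (k + 1)) q,
          LinearIndependent ℝ ![X, η q] → δ ≤ extCurv φ ψ q X (η q))) →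
      ∀ c : ℝ, IsSingularPrincipalCurvature D o μ φ p c → c < 0) := by
  obtain ⟨hps, e, hpe, he, hd, -⟩ := id hp
  obtain ⟨n, hn, hρ⟩ := hfront.exists_section_inner_ne_zero hμ he hpe hps hd
  refine ⟨?_, ?_, ?_, ?_⟩
  · rintro ⟨U, hU, C, hC⟩
    have hη := he.isNullLift hfront.coherent_fst hμ hpe hn
    exact hfront.formII_eq_zero_of_extCurvOn_abs_le hη hps hd hρ hU hC
  · intro U hU hsign
    exact hfront.exists_extCurvOn_abs_le hμ he hpe hps hd hn hρ hU hsign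
  · rintro ⟨U, hU, hK⟩ c hc
    exact hfront.isSingularPrincipalCurvature_nonpos hμ hp hU hK hc
  · rintro ⟨U, η, δ, hUo, hpU, hδ, hη, hnull, hK⟩ c hc
    have hU := hUo.mem_nhds hpU
    exact hfront.isSingularPrincipalCurvature_neg hμ hp hU (hη.contMDiffAt hU) hδ hnull hK hc
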